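/- Let $n\ge 1$. For $\alpha\in\mathbb Z^n$ let $e_\alpha(z)=z_1^{\alpha_1}\cdots z_n^{\alpha_n}$, defined at those $z\in\mathbb C^n$ with $z_j\ne 0$ whenever $\alpha_j<0$. A \emph{monomial polyhedron} is a bounded domain (nonempty connected open set) $\mathscr U\subset\mathbb C^n$ for which there are $\alpha^1,\dots,\alpha^n\in\mathbb Z^n$ with $$\mathscr U=\{z\in\mathbb C^n:\ |e_{\alpha^1}(z)|<1,\dots,|e_{\alpha^n}(z)|<1\},$$ where $|e_{\alpha^k}(z)|<1$ includes the requirement that $e_{\alpha^k}$ be defined at $z$. For $1<p<\infty$ let $A^p(\mathscr U)$ be the space of holomorphic functions in $L^p(\mathscr U)$ (with respect to Lebesgue measure $dV$), let $\mathcal S_p(\mathscr U)=\{\alpha\in\mathbb Z^n: e_\alpha\in A^p(\mathscr U)\}$ (in particular $e_\alpha$ is defined on all of $\mathscr U$), let $\chi_p(w)=(w_1|w_1|^{p-2},\dots,w_n|w_n|^{p-2})$ (a zero coordinate being sent to zero), and define the Monomial Basis Kernel $$K_{p,1}^{\mathscr U}(z,w)=\sum_{\alpha\in\mathcal S_p(\mathscr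 U)}\frac{e_\alpha(z)\,\overline{e_\alpha(\chi_p(w))}}{\int_{\mathscr U}|e_\alpha|^p\,dV},\qquad z,w\in\mathscr U.$$ \textbf{Theorem.} Let $1<p<\infty$ and let $\mathscr U\subset\mathbb C^n$ be a monomial polyhedron. Then the series defining $K_{p,1}^{\mathscr U}(z,w)$ converges absolutely for all $z,w\in\mathscr U$, and the operator $$(\boldsymbol P^{\mathscr U}_{p,1})^+f(z)=\int_{\mathscr U}\bigl|K_{p,1}^{\mathscr U}(z,w)\bigr|\,f(w)\,dV(w)$$ is bounded from $L^p(\mathscr U)$ to itself: there is a constant $C$ (depending on $\mathscr U$ and $p$) such that for every $f\in L^p(\mathscr U)$ the integral converges absolutely for almost every $z\in\mathscr U$, the resulting function belongs to $L^p(\mathscr U)$, and $$\|(\boldsymbol P^{\mathscr U}_{p,1})^+f\|_{L^p(\mathscr U)}\le C\,\|f\|_{L^p(\mathscr U)}.$$ -/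

import Mathlib

open MeasureTheory
open scoped NNReal ENNReal ComplexConjugate

noncomputable section

namespace MonomialBasis

/-- The Laurent monomial `e_α(z) = z₁^α₁ ⋯ zₙ^αₙ`, `α ∈ ℤⁿ`. Only its values at points where
it is defined (see `DefinedAt`) are ever used. -/
def laurentMonomial {n : ℕ} (α : Fin n → ℤ) (z : Fin n → ℂ) : ℂ :=
  ∏ j, z j ^ α j

/-- `e_α` is defined at `z`: no coordinate raised to a negative power vanishes.
(This has to be said explicitly, since `0 ^ (-k) = 0` in Mathlib for `k > 0`.) -/
def DefinedAt {n : ℕ} (α : Fin n → ℤ) (z : Fin n → ℂ) : Prop :=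
  ∀ j, α j < 0 → z j ≠ 0

/-- A monomial polyhedron in `ℂⁿ`: a bounded domain (nonempty connected open set) of the form
`{z : |e_{α¹}(z)| < 1, …, |e_{αⁿ}(z)| < 1}` for some `n` Laurent monomials. -/
structure IsMonomialPolyhedron {n : ℕ} (U : Set (Fin n → ℂ)) : Prop where
  isOpen : IsOpen U
  isConnected : IsConnected U
  isBounded : Bornology.IsBounded U
  exists_monomials : ∃ α : Fin n → (Fin n → ℤ),
    U = {z | ∀ k, DefinedAt (α k) z ∧ ‖laurentMonomial (α k) z‖ < 1}

/-- The Bergman space `A^p(U) = L^p(U) ∩ 𝒪(U)`, as a predicate on functions. -/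
def MemBergman {n : ℕ} (p : ℝ) (U : Set (Fin n → ℂ)) (f : (Fin n → ℂ) → ℂ) : Prop :=
  DifferentiableOn ℂ f U ∧ MemLp f (ENNReal.ofReal p) (volume.restrict U)

/-- The set `𝒮_p(U)` of `p`-allowable indices: those `α ∈ ℤⁿ` for which `e_α` is a function on
`U` that belongs to `A^p(U)`. -/
def allowableIndices {n : ℕ} (p : ℝ) (U : Set (Fin n → ℂ)) : Set (Fin n → ℤ) :=
  {α | (∀ z ∈ U, DefinedAt α z) ∧ MemBergman p U (laurentMonomial α)}

/-- The twisting map `χ_p(ζ) = (ζ₁|ζ₁|^{p-2}, …, ζₙ|ζₙ|^{p-2})`; for `p > 1` it sends a zero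
coordinate to zero. -/
def twist {n : ℕ} (p : ℝ) (ζ : Fin n → ℂ) : Fin n → ℂ :=
  fun j => ζ j * ((‖ζ j‖ ^ (p - 2) : ℝ) : ℂ)

/-- `‖e_α‖_p^p = ∫_U |e_α|^p dV`. -/
def monomialNormPow {n : ℕ} (p : ℝ) (U : Set (Fin n → ℂ)) (α : Fin n → ℤ) : ℝ :=
  ∫ z in U, ‖laurentMonomial α z‖ ^ p

/-- The term `e_α(z) · conj (χ_p^* e_α (w)) / ‖e_α‖_p^p` of the Monomial Basis Kernel. -/
def kernelTerm {n : ℕ} (p : ℝ) (U : Set (Fin n → ℂ)) (z w : Fin n → ℂ) (α : Fin n → ℤ) : ℂ :=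
  laurentMonomial α z * conj (laurentMonomial α (twist p w)) / (monomialNormPow p U α : ℂ)

/-- The (unweighted) Monomial Basis Kernel `K_{p,1}^U(z,w)` of `A^p(U)`. -/
def monomialBasisKernel {n : ℕ} (p : ℝ) (U : Set (Fin n → ℂ)) (z w : Fin n → ℂ) : ℂ :=
  ∑' α : allowableIndices p U, kernelTerm p U z w (α : Fin n → ℤ)

/-- The absolute operator `f ↦ ∫_U |K_{p,1}^U(z,w)| f(w) dV(w)`. -/
def absoluteOperator {n : ℕ} (p : ℝ) (U : Set (Fin n → ℂ)) (f : (Fin n → ℂ) → ℂ)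
    (z : Fin n → ℂ) : ℂ :=
  ∫ w in U, ‖monomialBasisKernel p U z w‖ • f w

end MonomialBasis

end

/-!
The idea is to write the kernel in closed form and to reduce everything to a one-variable Schur
estimate, by working in the coordinates given by the defining monomials themselves.

Boundedness of the polyhedron forces the matrix of the exponents `α k` to be invertible, with an
inverse `B` that has nonnegative entries (`isAdmissible_of_isBounded`). In the coordinates
`y k = -log |e_{α k}(z)|` the polyhedron is the positive orthant and Lebesgue measure is a product
of exponential densities (`setLIntegral_prod_level`). Hence the norms of the monomials are
explicit, and an index `β` is allowable exactly when each of the numbers `(β B) k` lies in a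
certain up-set of the line (`mem_allowableIndices_iff`). Nonnegativity of `B` enters in the
treatment of the coordinate hyperplanes that meet the polyhedron.

It follows that each allowable index is uniquely `β + ∑ k, γ k • α k` with `γ` in `ℕⁿ` and `β` in a
finite set (`indexEquiv`, `finite_fundamentalIndices`). For fixed `β` the series over `γ` is a
product of series `∑ (a + p m) s ^ m`, where `s = e_{α k}(z) * conj (e_{α k}(χ_p w))` has modulus
less than one. So the kernel converges absolutely, and it is dominated by a finite sum of
terms `|e_β(z)| |e_β(w)| ^ (p - 1) ∏ k, |1 - s k|⁻²` (`monomialBasisKernel_eq_tsum`,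
`norm_closedKernel_le`).

Each of these terms is treated by `schur_test`. The test function depends only on the moduli of
the coordinates, and so the product of the `|1 - s k|⁻²` may be averaged over the torus. As the
integer matrix of exponents induces a measure preserving endomorphism of the torus, the average is
the product of the `1 / (1 - |s k|²)`, by the Poisson formula (`setLIntegral_mul_prod_inv_sq`).
This gain of one power over `|1 - s k|⁻²` makes the operator bounded: what remains is a
product of Hilbert-type kernels `1 / (1 - u v)` in one variable, for which the test function
`(1 - v) ^ (-1 / p)`, times the weight `|e_β|`, works (`exists_lintegral_exp_le`).
-/

open MeasureTheory
open scoped NNReal ENNReal ComplexConjugate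

noncomputable section

namespace MonomialBasis

variable {n : ℕ} {α : Fin n → Fin n → ℤ}

/-! ### Product measures -/

/-- Tonelli's theorem for a product of functions of one variable each. -/
theorem lintegral_pi_prod {X : Type*} [MeasurableSpace X] : ∀ {n : ℕ} (μ : Fin n → Measure X)
    [∀ k, SigmaFinite (μ k)] (f : Fin n → X → ℝ≥0∞) (_ : ∀ k, Measurable (f k)),
    ∫⁻ x, ∏ k, f k (x k) ∂(Measure.pi μ) = ∏ k, ∫⁻ x, f k x ∂(μ k)
  | 0, μ, _, f, hf => by simp
  | n + 1, μ, _, f, hf => by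
    have h := (measurePreserving_piFinSuccAbove μ 0).symm
    rw [← h.lintegral_comp (by fun_prop), Fin.prod_univ_succ,
      ← lintegral_pi_prod (fun k => μ k.succ) (fun k => f k.succ) (fun k => hf _)]
    have hm : Measurable fun x : Fin n → X => ∏ k, f k.succ (x k) :=
      Finset.measurable_prod _ fun k _ => (hf k.succ).comp (measurable_pi_apply k)
    rw [← lintegral_prod_mul (hf 0).aemeasurable hm.aemeasurable]
    refine lintegral_congr fun x => ?_
    rw [Fin.prod_univ_succ]
    rfl

theorem pi_withDensity {X : Type*} [MeasurableSpace X] {n : ℕ} (μ : Measure X)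
    [SigmaFinite μ] (f : X → ℝ≥0∞) (hf : Measurable f) [SigmaFinite (μ.withDensity f)] :
    Measure.pi (fun _ : Fin n => μ.withDensity f) =
      (Measure.pi fun _ : Fin n => μ).withDensity fun x => ∏ k, f (x k) := by
  refine Measure.pi_eq fun s hs => ?_
  rw [withDensity_apply _ (MeasurableSet.univ_pi hs),
    ← lintegral_indicator (MeasurableSet.univ_pi hs)]
  have : ∀ x : Fin n → X, (Set.univ.pi s).indicator (fun x => ∏ k, f (x k)) x =
      ∏ k, (s k).indicator f (x k) := by
    intro x
    by_cases hx : x ∈ Set.univ.pi s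
    · rw [Set.indicator_of_mem hx]
      refine Finset.prod_congr rfl fun k _ => ?_
      rw [Set.indicator_of_mem (hx k trivial)]
    · rw [Set.indicator_of_notMem hx]
      simp only [Set.mem_pi, Set.mem_univ, true_implies, not_forall] at hx
      obtain ⟨k, hk⟩ := hx
      exact (Finset.prod_eq_zero (Finset.mem_univ k) (Set.indicator_of_notMem hk _)).symm
  simp_rw [this]
  rw [lintegral_pi_prod _ (fun k => (s k).indicator f) (fun k => hf.indicator (hs k))]
  refine Finset.prod_congr rfl fun k _ => ?_
  rw [lintegral_indicator (hs k), withDensity_apply _ (hs k)]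

/-! ### Schur's test -/

/-- **Schur's test** on `L^p` with a test function on each side. The exponents are normalized so
that no conjugate exponent appears: classically the hypotheses are stated for `a ^ (1 / q)`, with
`1 / p + 1 / q = 1`, and `a ^ (p - 1)` is its `p`-th power. -/
theorem schur_test {X Y : Type*} [MeasurableSpace X] [MeasurableSpace Y] {μ : Measure X}
    {ν : Measure Y} [SFinite μ] [SFinite ν] {p : ℝ} (hp : 1 < p) {K : X → Y → ℝ≥0∞}
    (hK : Measurable (Function.uncurry K)) {a : Y → ℝ≥0∞} {b : X → ℝ≥0∞} (ha : Measurable a)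
    (hb : Measurable b) (ha0 : ∀ᵐ y ∂ν, a y ≠ 0) (ha1 : ∀ᵐ y ∂ν, a y ≠ ∞) {C₁ C₂ : ℝ≥0∞}
    (h₁ : ∀ᵐ x ∂μ, ∫⁻ y, K x y * a y ∂ν ≤ C₁ * b x)
    (h₂ : ∀ᵐ y ∂ν, ∫⁻ x, K x y * b x ^ (p - 1) ∂μ ≤ C₂ * a y ^ (p - 1))
    {g : Y → ℝ≥0∞} (hg : AEMeasurable g ν) :
    ∫⁻ x, (∫⁻ y, K x y * g y ∂ν) ^ p ∂μ ≤ C₁ ^ (p - 1) * C₂ * ∫⁻ y, g y ^ p ∂ν := by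
  have hp0 : 0 < p := by linarith
  have hp1 : 0 < p - 1 := by linarith
  have hq : (p / (p - 1)).HolderConjugate p := (Real.HolderConjugate.conjExponent hp).symm
  have hKm : ∀ x, Measurable (K x) := fun x => hK.comp measurable_prodMk_left
  have hKm' : ∀ y, Measurable fun x => K x y := fun y => hK.comp measurable_prodMk_right
  have step : ∀ᵐ x ∂μ, (∫⁻ y, K x y * g y ∂ν) ^ p ≤
      C₁ ^ (p - 1) * ∫⁻ y, b x ^ (p - 1) * (K x y * (g y ^ p * a y ^ (-(p - 1)))) ∂ν := by
    filter_upwards [h₁] with x hx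
    have hol := ENNReal.lintegral_mul_le_Lp_mul_Lq ν hq
      (f := fun y => (K x y * a y) ^ ((p - 1) / p))
      (g := fun y => (K x y * (g y ^ p * a y ^ (-(p - 1)))) ^ (1 / p))
      (((hKm x).mul ha).pow_const _).aemeasurable
      (((hKm x).aemeasurable.mul ((hg.pow_const _).mul (ha.pow_const _).aemeasurable)).pow_const _)
    -- the powers of `a` cancel, since `(p - 1) / p` is the reciprocal of the conjugate exponent
    have e1 : ∫⁻ y, K x y * g y ∂ν = ∫⁻ y, ((fun y => (K x y * a y) ^ ((p - 1) / p)) *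
        (fun y => (K x y * (g y ^ p * a y ^ (-(p - 1)))) ^ (1 / p))) y ∂ν := by
      refine lintegral_congr_ae ?_
      filter_upwards [ha0, ha1] with y hy0 hy1
      have q0 : 0 ≤ (p - 1) / p := by positivity
      have q1 : 0 ≤ 1 / p := by positivity
      simp only [Pi.mul_apply]
      rw [ENNReal.mul_rpow_of_nonneg _ _ q0, ENNReal.mul_rpow_of_nonneg _ _ q1,
        ENNReal.mul_rpow_of_nonneg _ _ q1, ← ENNReal.rpow_mul, ← ENNReal.rpow_mul]
      have k1 : K x y ^ ((p - 1) / p) * K x y ^ (1 / p) = K x y := by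
        rw [← ENNReal.rpow_add_of_nonneg _ _ q0 q1]
        have : (p - 1) / p + 1 / p = 1 := by field_simp; ring
        rw [this, ENNReal.rpow_one]
      have k2 : a y ^ ((p - 1) / p) * a y ^ (-(p - 1) * (1 / p)) = 1 := by
        rw [← ENNReal.rpow_add _ _ hy0 hy1]
        have : (p - 1) / p + -(p - 1) * (1 / p) = 0 := by field_simp; ring
        rw [this, ENNReal.rpow_zero]
      have k3 : g y ^ (p * (1 / p)) = g y := by
        have : p * (1 / p) = 1 := by field_simp
        rw [this, ENNReal.rpow_one]
      rw [k3]
      calc K x y * g y = (K x y ^ ((p - 1) / p) * K x y ^ (1 / p)) * g y *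
            (a y ^ ((p - 1) / p) * a y ^ (-(p - 1) * (1 / p))) := by rw [k1, k2, mul_one]
        _ = _ := by ring
    rw [e1]
    refine (ENNReal.rpow_le_rpow hol hp0.le).trans ?_
    rw [ENNReal.mul_rpow_of_nonneg _ _ hp0.le, ← ENNReal.rpow_mul, ← ENNReal.rpow_mul]
    have e2 : 1 / (p / (p - 1)) * p = p - 1 := by field_simp
    have e3 : 1 / p * p = 1 := by field_simp
    have e4 : (p - 1) / p * (p / (p - 1)) = 1 := by field_simp
    rw [e2, e3, ENNReal.rpow_one]
    simp_rw [← ENNReal.rpow_mul, e3, e4, ENNReal.rpow_one]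
    have hm : AEMeasurable (fun y => K x y * (g y ^ p * a y ^ (-(p - 1)))) ν :=
      (hKm x).aemeasurable.mul ((hg.pow_const _).mul (ha.pow_const _).aemeasurable)
    rw [lintegral_const_mul'' _ hm, ← mul_assoc]
    refine mul_le_mul_left ((ENNReal.rpow_le_rpow hx hp1.le).trans_eq ?_) _
    rw [ENNReal.mul_rpow_of_nonneg _ _ hp1.le]
  refine (lintegral_mono_ae step).trans ?_
  have hF : AEMeasurable (Function.uncurry fun x y =>
      b x ^ (p - 1) * (K x y * (g y ^ p * a y ^ (-(p - 1))))) (μ.prod ν) := by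
    refine ((hb.comp measurable_fst).pow_const _).aemeasurable.mul (hK.aemeasurable.mul ?_)
    exact (hg.comp_snd.pow_const _).mul ((ha.comp measurable_snd).pow_const _).aemeasurable
  have hm : AEMeasurable
      (fun x => ∫⁻ y, b x ^ (p - 1) * (K x y * (g y ^ p * a y ^ (-(p - 1)))) ∂ν) μ :=
    hF.lintegral_prod_right'
  rw [lintegral_const_mul'' _ hm, lintegral_lintegral_swap hF, mul_assoc]
  refine mul_le_mul_right ?_ _
  rw [← lintegral_const_mul'' _ (hg.pow_const _)]
  refine lintegral_mono_ae ?_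
  filter_upwards [h₂, ha0, ha1] with y hy hy0 hy1
  calc ∫⁻ x, b x ^ (p - 1) * (K x y * (g y ^ p * a y ^ (-(p - 1)))) ∂μ
      = (∫⁻ x, K x y * b x ^ (p - 1) ∂μ) * (g y ^ p * a y ^ (-(p - 1))) := by
        have hm : Measurable fun x => K x y * b x ^ (p - 1) := (hKm' y).mul (hb.pow_const _)
        rw [← lintegral_mul_const _ hm]
        exact lintegral_congr fun x => by ring
    _ ≤ C₂ * a y ^ (p - 1) * (g y ^ p * a y ^ (-(p - 1))) := mul_le_mul_left hy _
    _ = C₂ * g y ^ p * (a y ^ (p - 1) * a y ^ (-(p - 1))) := by ring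
    _ = C₂ * g y ^ p := by
        rw [← ENNReal.rpow_add _ _ hy0 hy1, add_neg_cancel, ENNReal.rpow_zero, mul_one]

/-! ### One-variable integrals -/

/-- The one-variable Schur estimate. In terms of `v = exp (-y)` it bounds
`∫₀¹ v ^ (τ - 1) * (1 - v) ^ (-s) / (1 - u * v) dv` by a multiple of `(1 - u) ^ (-s)`: away from
`v = 1` only `τ > 0` matters, and near `v = 1` the integrand is comparable to
`y ^ (-s) / max (1 - u) y`. -/
theorem exists_lintegral_exp_le {τ s : ℝ} (hτ : 0 < τ) (hs : 0 < s) (hs1 : s < 1) :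
    ∃ C : ℝ≥0, ∀ u : ℝ, 0 ≤ u → u < 1 →
      ∫⁻ y in Set.Ioi (0 : ℝ), ENNReal.ofReal
        (Real.exp (-(τ * y)) * (1 - Real.exp (-y)) ^ (-s) * (1 - u * Real.exp (-y))⁻¹) ≤
        C * ENNReal.ofReal ((1 - u) ^ (-s)) := by
  refine ⟨Real.toNNReal (4 * (1 / τ + (1 / (1 - s) + 1 / s))), fun u hu0 hu1 => ?_⟩
  set δ := 1 - u with hδ
  have hδ0 : 0 < δ := by linarith
  have hδ1 : δ ≤ 1 := by linarith
  have hs1' : 0 < 1 - s := by linarith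
  -- the bound by `exp` is the relevant one for `y ≥ 1`, the other one for `y ≤ 1`
  have key : ∀ y : ℝ, 0 < y →
      Real.exp (-(τ * y)) * (1 - Real.exp (-y)) ^ (-s) * (1 - u * Real.exp (-y))⁻¹ ≤
        4 * (Real.exp (-(τ * y)) + y ^ (-s) * (max δ y)⁻¹) := by
    intro y hy
    have hE0 : 0 < Real.exp (-y) := Real.exp_pos _
    have hE1 : Real.exp (-y) ≤ (1 + y)⁻¹ := by
      rw [Real.exp_neg]
      exact inv_anti₀ (by linarith) (by linarith [Real.add_one_le_exp y])
    have hE2 : y / (1 + y) ≤ 1 - Real.exp (-y) := by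
      have : y / (1 + y) = 1 - (1 + y)⁻¹ := by field_simp; ring
      linarith
    have hEt : Real.exp (-(τ * y)) ≤ 1 := Real.exp_le_one_iff.2 (by nlinarith)
    have hm : 0 < max δ y := lt_max_of_lt_left hδ0
    have hpos : 0 < 1 - Real.exp (-y) := lt_of_lt_of_le (by positivity) hE2
    have hd1 : 1 - Real.exp (-y) ≤ 1 - u * Real.exp (-y) := by nlinarith
    have hd2 : δ ≤ 1 - u * Real.exp (-y) := by
      have : Real.exp (-y) < 1 := by linarith
      nlinarith
    have two : (2 : ℝ) ^ s ≤ 2 := by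
      simpa using Real.rpow_le_rpow_of_exponent_le (by norm_num : (1 : ℝ) ≤ 2) hs1.le
    rcases le_total y 1 with hy1 | hy1
    · have h2 : y / 2 ≤ 1 - Real.exp (-y) :=
        le_trans (div_le_div_of_nonneg_left hy.le (by linarith) (by linarith)) hE2
      have a1 : (1 - Real.exp (-y)) ^ (-s) ≤ 2 * y ^ (-s) := by
        calc (1 - Real.exp (-y)) ^ (-s) ≤ (y / 2) ^ (-s) :=
              Real.rpow_le_rpow_of_nonpos (by positivity) h2 (by linarith)
          _ = y ^ (-s) * 2 ^ s := by
              rw [Real.div_rpow hy.le (by norm_num), Real.rpow_neg (by norm_num : (0:ℝ) ≤ 2),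
                div_inv_eq_mul]
          _ ≤ 2 * y ^ (-s) := by nlinarith [Real.rpow_pos_of_pos hy (-s)]
      have a2 : (1 - u * Real.exp (-y))⁻¹ ≤ 2 * (max δ y)⁻¹ := by
        have : max δ y / 2 ≤ 1 - u * Real.exp (-y) := by
          rcases max_cases δ y with h | h <;> linarith
        calc _ ≤ (max δ y / 2)⁻¹ := inv_anti₀ (by positivity) this
          _ = _ := by rw [inv_div, div_eq_mul_inv]
      calc _ ≤ 1 * (2 * y ^ (-s)) * (2 * (max δ y)⁻¹) := by
            gcongr
            exact inv_nonneg.2 (hpos.le.trans hd1)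
        _ = 4 * (0 + y ^ (-s) * (max δ y)⁻¹) := by ring
        _ ≤ _ := by gcongr; positivity
    · have h2 : (1 / 2 : ℝ) ≤ 1 - Real.exp (-y) := by
        refine le_trans ?_ hE2
        rw [div_le_div_iff₀ (by norm_num) (by linarith)]
        linarith
      have a1 : (1 - Real.exp (-y)) ^ (-s) ≤ 2 := by
        calc (1 - Real.exp (-y)) ^ (-s) ≤ (1 / 2 : ℝ) ^ (-s) :=
              Real.rpow_le_rpow_of_nonpos (by positivity) h2 (by linarith)
          _ = 2 ^ s := by
              rw [one_div, Real.inv_rpow (by norm_num), Real.rpow_neg (by norm_num : (0:ℝ) ≤ 2),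
                inv_inv]
          _ ≤ 2 := two
      have a2 : (1 - u * Real.exp (-y))⁻¹ ≤ 2 := by
        calc _ ≤ (1 / 2 : ℝ)⁻¹ := inv_anti₀ (by positivity) (by linarith)
          _ = 2 := by norm_num
      calc _ ≤ Real.exp (-(τ * y)) * 2 * 2 := by
            gcongr
            exact inv_nonneg.2 (hpos.le.trans hd1)
        _ = 4 * (Real.exp (-(τ * y)) + 0) := by ring
        _ ≤ _ := by gcongr; positivity
  have hδs : 1 ≤ δ ^ (-s) := Real.one_le_rpow_of_pos_of_le_one_of_nonpos hδ0 hδ1 (by linarith)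
  have i1 : ∫⁻ y in Set.Ioi (0 : ℝ), ENNReal.ofReal (Real.exp (-(τ * y))) ≤
      ENNReal.ofReal (1 / τ * δ ^ (-s)) := by
    have hint : IntegrableOn (fun y => Real.exp (-(τ * y))) (Set.Ioi 0) := by
      simpa only [neg_mul] using exp_neg_integrableOn_Ioi 0 hτ
    rw [← ofReal_integral_eq_lintegral_ofReal hint (ae_of_all _ fun y => (Real.exp_pos _).le)]
    have : ∫ y in Set.Ioi (0 : ℝ), Real.exp (-(τ * y)) = 1 / τ := by
      have := integral_exp_mul_Ioi (neg_lt_zero.2 hτ) 0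
      simp only [neg_mul, mul_zero, Real.exp_zero] at this
      rw [this]; field_simp
    rw [this]
    exact ENNReal.ofReal_le_ofReal (le_mul_of_one_le_right (by positivity) hδs)
  have i2 : ∫⁻ y in Set.Ioc (0 : ℝ) δ, ENNReal.ofReal (y ^ (-s) * (max δ y)⁻¹) =
      ENNReal.ofReal (1 / (1 - s) * δ ^ (-s)) := by
    have hint : IntegrableOn (fun y : ℝ => y ^ (-s) * δ⁻¹) (Set.Ioc 0 δ) := by
      have hr : IntervalIntegrable (fun y : ℝ => y ^ (-s)) volume 0 δ :=
        intervalIntegral.intervalIntegrable_rpow' (by linarith)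
      exact (hr.mul_const _).1
    rw [setLIntegral_congr_fun (g := fun y => ENNReal.ofReal (y ^ (-s) * δ⁻¹)) measurableSet_Ioc
      (fun y hy => by simp only [max_eq_left hy.2]),
      ← ofReal_integral_eq_lintegral_ofReal hint
        ((ae_restrict_iff' measurableSet_Ioc).2 (ae_of_all _ fun y hy =>
          mul_nonneg (Real.rpow_nonneg hy.1.le _) (inv_nonneg.2 hδ0.le))),
      integral_mul_const, ← intervalIntegral.integral_of_le hδ0.le,
      integral_rpow (Or.inl (by linarith)), Real.zero_rpow (by linarith), sub_zero,
      Real.rpow_add_one hδ0.ne']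
    congr 1
    rw [add_comm (-s) 1, ← sub_eq_add_neg]
    field_simp
  have i3 : ∫⁻ y in Set.Ioi δ, ENNReal.ofReal (y ^ (-s) * (max δ y)⁻¹) =
      ENNReal.ofReal (1 / s * δ ^ (-s)) := by
    have hlt : -s - 1 < -1 := by linarith
    have hint : IntegrableOn (fun y : ℝ => y ^ (-s - 1)) (Set.Ioi δ) :=
      integrableOn_Ioi_rpow_of_lt hlt hδ0
    rw [setLIntegral_congr_fun (g := fun y => ENNReal.ofReal (y ^ (-s - 1))) measurableSet_Ioi
      (fun y hy => by
        have hy' : δ < y := hy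
        simp only [max_eq_right hy'.le]
        rw [Real.rpow_sub_one (hδ0.trans hy').ne', div_eq_mul_inv]),
      ← ofReal_integral_eq_lintegral_ofReal hint
        ((ae_restrict_iff' measurableSet_Ioi).2 (ae_of_all _ fun y hy =>
          Real.rpow_nonneg (hδ0.trans hy).le _)), integral_Ioi_rpow_of_lt hlt hδ0]
    congr 1
    rw [sub_add_cancel]
    field_simp
  calc _ ≤ ∫⁻ y in Set.Ioi (0 : ℝ), 4 * (ENNReal.ofReal (Real.exp (-(τ * y))) +
          ENNReal.ofReal (y ^ (-s) * (max δ y)⁻¹)) := by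
        refine setLIntegral_mono' measurableSet_Ioi fun y hy => ?_
        have hy' : 0 < y := hy
        refine (ENNReal.ofReal_le_ofReal (key y hy)).trans_eq ?_
        rw [ENNReal.ofReal_mul (by norm_num), ENNReal.ofReal_add (by positivity) (by positivity)]
        norm_num
    _ = 4 * ((∫⁻ y in Set.Ioi (0 : ℝ), ENNReal.ofReal (Real.exp (-(τ * y)))) +
          ((∫⁻ y in Set.Ioc (0 : ℝ) δ, ENNReal.ofReal (y ^ (-s) * (max δ y)⁻¹)) +
            ∫⁻ y in Set.Ioi δ, ENNReal.ofReal (y ^ (-s) * (max δ y)⁻¹))) := by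
        rw [lintegral_const_mul _ (by fun_prop), lintegral_add_left (by fun_prop),
          ← lintegral_union measurableSet_Ioi (Set.Ioc_disjoint_Ioi le_rfl),
          Set.Ioc_union_Ioi_eq_Ioi hδ0.le]
    _ ≤ 4 * (ENNReal.ofReal (1 / τ * δ ^ (-s)) + (ENNReal.ofReal (1 / (1 - s) * δ ^ (-s)) +
          ENNReal.ofReal (1 / s * δ ^ (-s)))) := by
        rw [i2, i3]
        gcongr
    _ = _ := by
        have : (4 : ℝ≥0∞) = ENNReal.ofReal 4 := by norm_num
        change _ = ENNReal.ofReal _ * _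
        rw [← ENNReal.ofReal_mul (by positivity), ← ENNReal.ofReal_add (by positivity)
          (by positivity), ← ENNReal.ofReal_add (by positivity) (by positivity), this,
          ← ENNReal.ofReal_mul (by positivity)]
        congr 1
        ring

/-- The Poisson kernel has mean `1` over the circle. -/
theorem lintegral_unitAddCircle_inv_sq {c : ℂ} (hc : ‖c‖ < 1) :
    ∫⁻ θ : UnitAddCircle, ENNReal.ofReal ((‖1 - c * conj (AddCircle.toCircle θ : ℂ)‖ ^ 2)⁻¹) =
      ENNReal.ofReal ((1 - ‖c‖ ^ 2)⁻¹) := by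
  have hc2 : 0 < 1 - ‖c‖ ^ 2 := by nlinarith [norm_nonneg c]
  have hne : ∀ θ : UnitAddCircle, 0 < ‖1 - c * conj (AddCircle.toCircle θ : ℂ)‖ := by
    intro θ
    rw [norm_pos_iff, sub_ne_zero]
    intro h
    have := congrArg norm h
    rw [norm_one, norm_mul, RCLike.norm_conj, Circle.norm_coe, mul_one] at this
    linarith
  have hcont : Continuous fun θ : UnitAddCircle =>
      (‖1 - c * conj (AddCircle.toCircle θ : ℂ)‖ ^ 2)⁻¹ := by
    refine Continuous.inv₀ ?_ fun θ => (pow_pos (hne θ) 2).ne'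
    have := AddCircle.continuous_toCircle (T := 1)
    fun_prop
  rw [← ofReal_integral_eq_lintegral_ofReal
    (hcont.integrable_of_hasCompactSupport (HasCompactSupport.of_compactSpace _))
    (ae_of_all _ fun θ => by positivity)]
  congr 1
  have P := DiffContOnCl.circleAverage_poissonKernel_smul' (E := ℂ) (f := fun _ => (1 : ℂ))
    (w := c) (c := 0) (R := 1) diffContOnCl_const (by simpa using hc)
  simp only [Real.circleAverage_def, Complex.real_smul, mul_one,
    intervalIntegral.integral_ofReal] at P
  norm_cast at P
  have h2π : (2 * Real.pi) ≠ 0 := by positivity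
  have hsc := intervalIntegral.integral_comp_mul_left (a := 0) (b := 1) (fun θ : ℝ =>
    ((‖circleMap 0 1 θ - 0‖ ^ 2 - ‖c - 0‖ ^ 2) /
      ‖(circleMap 0 1 θ - 0) - (c - 0)‖ ^ 2)) h2π
  rw [mul_zero, mul_one, smul_eq_mul] at hsc
  rw [← hsc] at P
  rw [← UnitAddCircle.intervalIntegral_preimage 0, zero_add]
  refine eq_inv_of_mul_eq_one_left ?_
  rw [← intervalIntegral.integral_mul_const]
  refine Eq.trans ?_ P
  refine intervalIntegral.integral_congr (μ := volume) fun t _ => ?_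
  have e : ((AddCircle.toCircle (t : UnitAddCircle) : Circle) : ℂ) =
      circleMap 0 1 (2 * Real.pi * t) := by
    rw [AddCircle.toCircle_apply_mk]
    simp [circleMap, Circle.coe_exp]
  have hn : ‖circleMap 0 1 (2 * Real.pi * t)‖ = 1 := by simp
  have e2 : ‖1 - c * conj (circleMap 0 1 (2 * Real.pi * t))‖ =
      ‖circleMap 0 1 (2 * Real.pi * t) - c‖ := by
    have : circleMap 0 1 (2 * Real.pi * t) - c = circleMap 0 1 (2 * Real.pi * t) *
        (1 - c * conj (circleMap 0 1 (2 * Real.pi * t))) := by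
      rw [mul_sub, mul_left_comm, Complex.mul_conj, Complex.normSq_eq_norm_sq, hn]
      simp
    rw [this, norm_mul, hn, one_mul]
  simp only [sub_zero, hn, e, e2]
  ring

/-! ### Multiple power series -/

/-- A product of `n` absolutely convergent series is an absolutely convergent series over `ℕⁿ`. -/
theorem summable_and_tsum_pi_prod : ∀ {n : ℕ} (f : Fin n → ℕ → ℂ)
    (_ : ∀ k, Summable fun m => ‖f k m‖),
    (Summable fun γ : Fin n → ℕ => ‖∏ k, f k (γ k)‖) ∧
    ∑' γ : Fin n → ℕ, ∏ k, f k (γ k) = ∏ k, ∑' m, f k m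
  | 0, f, _ => by
    refine ⟨(hasSum_fintype _).summable, ?_⟩
    simp
  | n + 1, f, hf => by
    obtain ⟨h1, h2⟩ := summable_and_tsum_pi_prod (fun k => f k.succ) (fun k => hf _)
    let e : ℕ × (Fin n → ℕ) ≃ (Fin (n + 1) → ℕ) := Fin.consEquiv (fun _ => ℕ)
    have he : ∀ x, ∏ k, f k (e x k) = f 0 x.1 * ∏ k : Fin n, f k.succ (x.2 k) := by
      intro x
      rw [Fin.prod_univ_succ]
      simp [e, Fin.consEquiv]
    constructor
    · rw [← e.summable_iff]
      refine (Summable.mul_norm (hf 0) h1).congr fun x => ?_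
      simp only [Function.comp_apply, he]
    · rw [← e.tsum_eq, Fin.prod_univ_succ, ← h2, tsum_mul_tsum_of_summable_norm (hf 0) h1]
      exact tsum_congr he

theorem summable_norm_affine_mul_pow (a b : ℝ) {s : ℂ} (hs : ‖s‖ < 1) :
    Summable fun m : ℕ => ‖((a + b * m : ℝ) : ℂ) * s ^ m‖ := by
  have h1 := (summable_norm_geometric_of_norm_lt_one hs).mul_left |a|
  have h2 := (summable_norm_pow_mul_geometric_of_norm_lt_one 1 hs).mul_left |b|
  refine Summable.of_nonneg_of_le (fun _ => norm_nonneg _) (fun m => ?_) (h1.add h2)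
  have : ((a + b * m : ℝ) : ℂ) * s ^ m = (a : ℂ) * s ^ m + (b : ℂ) * ((m : ℂ) ^ 1 * s ^ m) := by
    push_cast; ring
  rw [this]
  refine (norm_add_le _ _).trans_eq ?_
  rw [norm_mul (a : ℂ), norm_mul (b : ℂ)]
  simp

theorem tsum_affine_mul_pow (a b : ℝ) {s : ℂ} (hs : ‖s‖ < 1) :
    ∑' m : ℕ, ((a + b * m : ℝ) : ℂ) * s ^ m = (a + (b - a) * s) / (1 - s) ^ 2 := by
  have hs1 : 1 - s ≠ 0 := by
    rw [sub_ne_zero]; rintro rfl; simp at hs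
  have h1 := (hasSum_geometric_of_norm_lt_one hs).mul_left (a : ℂ)
  have h2 := (hasSum_coe_mul_geometric_of_norm_lt_one hs).mul_left (b : ℂ)
  have := (h1.add h2).tsum_eq
  rw [tsum_congr (g := fun m : ℕ => (a : ℂ) * s ^ m + (b : ℂ) * ((m : ℂ) * s ^ m))
    (fun m => by push_cast; ring), this]
  field_simp
  ring

/-! ### Torus averages -/

/-- The action of the torus on `ℂⁿ` by rotation of the coordinates; the torus is written
additively, as `(ℝ / ℤ)ⁿ`. -/
def rotate (θ : UnitAddTorus (Fin n)) (w : Fin n → ℂ) : Fin n → ℂ :=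
  fun j => (AddCircle.toCircle (θ j) : ℂ) * w j

theorem norm_rotate (θ : UnitAddTorus (Fin n)) (w : Fin n → ℂ) (j : Fin n) :
    ‖rotate θ w j‖ = ‖w j‖ := by
  rw [rotate, norm_mul, Circle.norm_coe, one_mul]

theorem continuous_rotate :
    Continuous fun x : UnitAddTorus (Fin n) × (Fin n → ℂ) => rotate x.1 x.2 := by
  have := AddCircle.continuous_toCircle (T := 1)
  unfold rotate
  fun_prop

theorem measurePreserving_rotate (θ : UnitAddTorus (Fin n)) :
    MeasurePreserving (rotate θ) volume volume :=
  volume_preserving_pi fun j => (rotation (AddCircle.toCircle (θ j))).measurePreserving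

/-- Lebesgue measure on `ℂⁿ` is unchanged by averaging over the torus action. -/
theorem lintegral_eq_lintegral_rotate {H : (Fin n → ℂ) → ℝ≥0∞} (hH : Measurable H) :
    ∫⁻ w, H w = ∫⁻ w, ∫⁻ θ : UnitAddTorus (Fin n), H (rotate θ w) := by
  have hm : Measurable fun x : UnitAddTorus (Fin n) × (Fin n → ℂ) => H (rotate x.1 x.2) :=
    hH.comp continuous_rotate.measurable
  have hm' : AEMeasurable (Function.uncurry fun (w : Fin n → ℂ) (θ : UnitAddTorus (Fin n)) =>
      H (rotate θ w)) (volume.prod volume) := (hm.comp measurable_swap).aemeasurable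
  rw [lintegral_lintegral_swap hm']
  have h1 : volume (Set.univ : Set (UnitAddTorus (Fin n))) = 1 := by
    rw [volume_pi, Measure.pi_univ]
    simp
  simp_rw [(measurePreserving_rotate _).lintegral_comp hH]
  rw [lintegral_const, h1, mul_one]

/-- A nonsingular integer matrix acts on the torus as a surjective endomorphism, which preserves
Haar measure. -/
theorem measurePreserving_matrix_torus {A : Matrix (Fin n) (Fin n) ℤ} (hA : A.det ≠ 0) :
    MeasurePreserving (fun (θ : UnitAddTorus (Fin n)) k => ∑ j, A k j • θ j) volume volume := by
  let φ : UnitAddTorus (Fin n) →+ UnitAddTorus (Fin n) :=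
    { toFun := fun θ k => ∑ j, A k j • θ j
      map_zero' := by ext k; simp
      map_add' := fun θ η => by ext k; simp [Finset.sum_add_distrib] }
  refine AddMonoidHom.measurePreserving (f := φ) ?_ ?_ rfl
  · change Continuous fun (θ : UnitAddTorus (Fin n)) k => ∑ j, A k j • θ j
    fun_prop
  · intro t
    choose τ hτ using fun k => QuotientAddGroup.mk_surjective (t k)
    have hu : IsUnit (A.map (Int.cast : ℤ → ℝ)).det := by
      rw [isUnit_iff_ne_zero]
      have := Int.cast_det (R := ℝ) A
      rw [← this]
      exact_mod_cast hA
    refine ⟨fun j => (((A.map (Int.cast : ℤ → ℝ))⁻¹.mulVec τ j : ℝ) : UnitAddCircle), ?_⟩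
    ext k
    change ∑ j, A k j • (((A.map (Int.cast : ℤ → ℝ))⁻¹.mulVec τ j : ℝ) : UnitAddCircle) = t k
    have h : (A.map (Int.cast : ℤ → ℝ)).mulVec ((A.map (Int.cast : ℤ → ℝ))⁻¹.mulVec τ) k = τ k := by
      rw [Matrix.mulVec_mulVec, Matrix.mul_nonsing_inv _ hu, Matrix.one_mulVec]
    rw [← hτ k]
    change _ = ((τ k : ℝ) : UnitAddCircle)
    rw [← h]
    simp only [Matrix.mulVec, dotProduct, Matrix.map_apply]
    have hs := map_sum (QuotientAddGroup.mk' (AddSubgroup.zmultiples (1 : ℝ)))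
      (fun j => (A k j : ℝ) * ∑ i, (A.map (Int.cast : ℤ → ℝ))⁻¹ j i * τ i) Finset.univ
    refine Eq.trans (Finset.sum_congr rfl fun j _ => ?_) hs.symm
    rw [← zsmul_eq_mul, map_zsmul]
    rfl

/-- The characters `θ ↦ ∏ j, e(θ j) ^ A k j` attached to the rows of a nonsingular integer matrix
are independent and uniformly distributed on the circle, so that the mean of the product of the
`|1 - c k * conj χ k|⁻²` is the product of the one-variable means. -/
theorem lintegral_torus_prod_inv_sq {A : Matrix (Fin n) (Fin n) ℤ} (hA : A.det ≠ 0)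
    {c : Fin n → ℂ} (hc : ∀ k, ‖c k‖ < 1) :
    ∫⁻ θ : UnitAddTorus (Fin n), ENNReal.ofReal (∏ k, (‖1 - c k *
        conj (∏ j, (AddCircle.toCircle (θ j) : ℂ) ^ A k j)‖ ^ 2)⁻¹) =
      ENNReal.ofReal (∏ k, (1 - ‖c k‖ ^ 2)⁻¹) := by
  have hcont := AddCircle.continuous_toCircle (T := 1)
  have hm : ∀ k, Measurable fun x : UnitAddCircle =>
      ENNReal.ofReal ((‖1 - c k * conj (AddCircle.toCircle x : ℂ)‖ ^ 2)⁻¹) := by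
    intro k
    have : Measurable fun x : UnitAddCircle =>
        ‖1 - c k * conj (AddCircle.toCircle x : ℂ)‖ ^ 2 := by
      apply Continuous.measurable
      fun_prop
    exact this.inv.ennreal_ofReal
  have h1 := lintegral_pi_prod (fun _ : Fin n => (volume : Measure UnitAddCircle)) _ hm
  have h2 := (measurePreserving_matrix_torus hA).lintegral_comp
    (f := fun θ => ∏ k, ENNReal.ofReal ((‖1 - c k * conj (AddCircle.toCircle (θ k) : ℂ)‖ ^ 2)⁻¹))
    (Finset.measurable_prod _ fun k _ => (hm k).comp (measurable_pi_apply k))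
  have hnn : ∀ k, 0 ≤ (1 - ‖c k‖ ^ 2)⁻¹ := fun k =>
    inv_nonneg.2 (by nlinarith [norm_nonneg (c k), hc k])
  rw [ENNReal.ofReal_prod_of_nonneg fun k _ => hnn k]
  simp_rw [← lintegral_unitAddCircle_inv_sq (hc _)]
  rw [← h1]
  refine Eq.trans (lintegral_congr fun θ => ?_) h2
  rw [ENNReal.ofReal_prod_of_nonneg fun k _ => by positivity]
  refine Finset.prod_congr rfl fun k _ => ?_
  have : ∏ j, (AddCircle.toCircle (θ j) : ℂ) ^ A k j =
      (AddCircle.toCircle (∑ j, A k j • θ j) : ℂ) := by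
    have hs : ∀ s : Finset (Fin n), (AddCircle.toCircle (∑ j ∈ s, A k j • θ j) : ℂ) =
        ∏ j ∈ s, (AddCircle.toCircle (θ j) : ℂ) ^ A k j := fun s => by
      induction s using Finset.cons_induction with
      | empty => simp
      | cons j s hj ih =>
        rw [Finset.sum_cons, Finset.prod_cons, AddCircle.toCircle_add, Circle.coe_mul, ih,
          AddCircle.toCircle_zsmul, Circle.coe_zpow]
    exact (hs _).symm
  rw [this]

/-! ### Logarithmic polar coordinates -/

/-- Polar coordinates with logarithmic radius. -/
theorem map_log_norm_volume :
    Measure.map (fun z : ℂ => Real.log ‖z‖) volume =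
      volume.withDensity fun x => ENNReal.ofReal (2 * Real.pi * Real.exp (2 * x)) := by
  refine Measure.ext_of_lintegral _ fun f hf => ?_
  have hlog : Measurable fun z : ℂ => Real.log ‖z‖ := by fun_prop
  rw [lintegral_map hf hlog, lintegral_withDensity_eq_lintegral_mul _ (by fun_prop) hf,
    ← Complex.lintegral_comp_polarCoord_symm, polarCoord_target, Measure.volume_eq_prod]
  simp only [Complex.norm_polarCoord_symm, Real.log_abs, smul_eq_mul]
  rw [setLIntegral_prod _ (by fun_prop)]
  have e : Set.Ioi (0 : ℝ) = Real.exp '' Set.univ := by rw [Set.image_univ, Real.range_exp]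
  simp only [lintegral_const, Measure.restrict_apply, MeasurableSet.univ, Set.univ_inter,
    Real.volume_Ioo]
  rw [e, lintegral_image_eq_lintegral_abs_deriv_mul MeasurableSet.univ
    (fun x _ => (Real.hasDerivAt_exp x).hasDerivWithinAt) Real.exp_injective.injOn,
    Measure.restrict_univ]
  refine lintegral_congr fun x => ?_
  rw [Real.log_exp, abs_of_pos (Real.exp_pos x), Pi.mul_apply, sub_neg_eq_add, ← two_mul,
    two_mul x, Real.exp_add, ENNReal.ofReal_mul (p := 2 * Real.pi) (by positivity),
    ENNReal.ofReal_mul (p := Real.exp x) (by positivity)]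
  ring

theorem lintegral_comp_log_norm {G : (Fin n → ℝ) → ℝ≥0∞} (hG : Measurable G) :
    ∫⁻ z : Fin n → ℂ, G (fun j => Real.log ‖z j‖) =
      ∫⁻ x, G x * ENNReal.ofReal (∏ j, (2 * Real.pi * Real.exp (2 * x j))) := by
  have hlog : Measurable fun z : ℂ => Real.log ‖z‖ := by fun_prop
  have hd : Measurable fun x : ℝ => ENNReal.ofReal (2 * Real.pi * Real.exp (2 * x)) := by fun_prop
  have hσ : SigmaFinite ((volume : Measure ℝ).withDensity
    fun x => ENNReal.ofReal (2 * Real.pi * Real.exp (2 * x))) := 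
    SigmaFinite.withDensity_ofReal _
  have hp : MeasurePreserving (fun (z : Fin n → ℂ) j => Real.log ‖z j‖) volume
      (Measure.pi fun _ => volume.withDensity
        fun x => ENNReal.ofReal (2 * Real.pi * Real.exp (2 * x))) :=
    measurePreserving_pi _ _ fun _ => ⟨hlog, map_log_norm_volume⟩
  have hdp : Measurable fun x : Fin n → ℝ =>
      ∏ k, ENNReal.ofReal (2 * Real.pi * Real.exp (2 * x k)) :=
    Finset.measurable_prod _ fun k _ => hd.comp (measurable_pi_apply k)
  rw [hp.lintegral_comp hG, pi_withDensity _ _ hd, lintegral_withDensity_eq_lintegral_mul _ hdp hG]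
  refine lintegral_congr fun x => ?_
  rw [Pi.mul_apply, mul_comm, ENNReal.ofReal_prod_of_nonneg fun j _ => by positivity]

/-- In the coordinates `y = -M (log |z₁|, …, log |zₙ|)`, Lebesgue measure on `ℂⁿ` becomes a constant
times a product of exponential densities on the line. -/
theorem lintegral_prod_comp_mulVec_log {M : Matrix (Fin n) (Fin n) ℝ} (hM : IsUnit M.det)
    {h : Fin n → ℝ → ℝ≥0∞} (hh : ∀ k, Measurable (h k)) :
    ∫⁻ z : Fin n → ℂ, ∏ k, h k (-(M.mulVec fun j => Real.log ‖z j‖) k) =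
      ENNReal.ofReal ((2 * Real.pi) ^ n * |M.det|⁻¹) *
        ∏ k, ∫⁻ y, h k y * ENNReal.ofReal (Real.exp (-(2 * (∑ j, M⁻¹ j k) * y))) := by
  have hm : ∀ k, Measurable fun y => h k y *
      ENNReal.ofReal (Real.exp (-(2 * (∑ j, M⁻¹ j k) * y))) := fun k =>
    (hh k).mul (by fun_prop)
  have hmap : Measurable fun x : Fin n → ℝ => ∏ k, h k (-(M.mulVec x) k) := by
    refine Finset.measurable_prod _ fun k _ => (hh k).comp ?_
    have : Continuous fun x : Fin n → ℝ => -(M.mulVec x) k := by fun_prop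
    exact this.measurable
  rw [lintegral_comp_log_norm hmap, ← lintegral_pi_prod _ _ hm]
  have hM0 : M.det ≠ 0 := hM.ne_zero
  have hN0 : (-M).det ≠ 0 := by
    rw [Matrix.det_neg]; exact mul_ne_zero (by simp) hM0
  have hmv := Real.map_matrix_volume_pi_eq_smul_volume_pi hN0
  have habs : |((-M).det)⁻¹| = |M.det|⁻¹ := by
    rw [abs_inv, Matrix.det_neg, abs_mul, abs_pow]; simp
  rw [habs] at hmv
  have hF : Measurable fun y : Fin n → ℝ => ∏ k, (h k (y k) *
      ENNReal.ofReal (Real.exp (-(2 * (∑ j, M⁻¹ j k) * y k)))) :=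
    Finset.measurable_prod _ fun k _ => (hm k).comp (measurable_pi_apply k)
  have key := congrArg (fun μ => ∫⁻ y, ∏ k, (h k (y k) *
      ENNReal.ofReal (Real.exp (-(2 * (∑ j, M⁻¹ j k) * y k)))) ∂μ) hmv
  rw [lintegral_map hF (by exact (LinearMap.continuous_of_finiteDimensional _).measurable),
    lintegral_smul_measure] at key
  rw [ENNReal.ofReal_mul (by positivity), mul_assoc, ← volume_pi]
  rw [smul_eq_mul] at key
  rw [← key, ← lintegral_const_mul' _ _ ENNReal.ofReal_ne_top]
  refine lintegral_congr fun x => ?_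
  have hx : ∀ k, Matrix.toLin' (-M) x k = -(M.mulVec x) k := fun k => by
    rw [Matrix.toLin'_apply, Matrix.neg_mulVec]; rfl
  simp only [hx]
  have hsum : ∑ j, 2 * x j = ∑ k, -(2 * (∑ j, M⁻¹ j k) * -(M.mulVec x) k) := by
    have hinv : M⁻¹.mulVec (M.mulVec x) = x := by
      rw [Matrix.mulVec_mulVec, Matrix.nonsing_inv_mul _ hM, Matrix.one_mulVec]
    calc ∑ j, 2 * x j = ∑ j, 2 * M⁻¹.mulVec (M.mulVec x) j := by rw [hinv]
      _ = ∑ j, ∑ k, 2 * (M⁻¹ j k * M.mulVec x k) := by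
          simp only [Matrix.mulVec, dotProduct, Finset.mul_sum]
      _ = ∑ k, ∑ j, 2 * (M⁻¹ j k * M.mulVec x k) := Finset.sum_comm
      _ = _ := Finset.sum_congr rfl fun k _ => by
          rw [Finset.mul_sum, Finset.sum_mul, ← Finset.sum_neg_distrib]
          exact Finset.sum_congr rfl fun j _ => by ring
  have hprod : ∏ j, (2 * Real.pi * Real.exp (2 * x j)) = (2 * Real.pi) ^ n *
      ∏ k, Real.exp (-(2 * (∑ j, M⁻¹ j k) * -(M.mulVec x) k)) := by
    rw [Finset.prod_mul_distrib, Finset.prod_const, Finset.card_univ, Fintype.card_fin,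
      ← Real.exp_sum, hsum, Real.exp_sum]
  rw [hprod, ENNReal.ofReal_mul (by positivity),
    ENNReal.ofReal_prod_of_nonneg fun k _ => (Real.exp_pos _).le, Finset.prod_mul_distrib]
  ring

/-! ### Laurent monomials -/

theorem norm_laurentMonomial (β : Fin n → ℤ) (z : Fin n → ℂ) :
    ‖laurentMonomial β z‖ = ∏ j, ‖z j‖ ^ β j := by
  simp [laurentMonomial, norm_prod]

theorem laurentMonomial_rotate (β : Fin n → ℤ) (θ : UnitAddTorus (Fin n)) (w : Fin n → ℂ) :
    laurentMonomial β (rotate θ w) =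
      (∏ j, (AddCircle.toCircle (θ j) : ℂ) ^ β j) * laurentMonomial β w := by
  simp only [laurentMonomial, rotate, mul_zpow, Finset.prod_mul_distrib]

theorem norm_laurentMonomial_rotate (β : Fin n → ℤ) (θ : UnitAddTorus (Fin n))
    (w : Fin n → ℂ) : ‖laurentMonomial β (rotate θ w)‖ = ‖laurentMonomial β w‖ := by
  simp only [norm_laurentMonomial, norm_rotate]

theorem definedAt_rotate (β : Fin n → ℤ) (θ : UnitAddTorus (Fin n)) (w : Fin n → ℂ) :
    DefinedAt β (rotate θ w) ↔ DefinedAt β w := by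
  refine forall₂_congr fun j _ => not_congr ?_
  rw [← norm_eq_zero, norm_rotate, norm_eq_zero]

@[fun_prop]
theorem measurable_laurentMonomial (β : Fin n → ℤ) : Measurable (laurentMonomial β) :=
  Finset.measurable_prod _ fun j _ => (measurable_pi_apply j).pow_const _

theorem differentiableOn_laurentMonomial {β : Fin n → ℤ} {U : Set (Fin n → ℂ)}
    (h : ∀ z ∈ U, DefinedAt β z) : DifferentiableOn ℂ (laurentMonomial β) U := by
  intro z hz
  refine DifferentiableAt.differentiableWithinAt ?_
  unfold laurentMonomial
  have hd : ∀ j, DifferentiableAt ℂ (fun z : Fin n → ℂ => z j ^ β j) z := fun j => by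
    refine DifferentiableAt.zpow (differentiableAt_apply j z) ?_
    by_contra! hc
    exact h z hz j hc.2 hc.1
  exact (HasFDerivAt.finsetProd fun j _ => (hd j).hasFDerivAt).differentiableAt

theorem ae_forall_ne_zero : ∀ᵐ z : Fin n → ℂ, ∀ j, z j ≠ 0 := by
  rw [ae_all_iff]
  intro j
  have h : ∀ᵐ x : ℂ, x ≠ 0 := by simp [ae_iff]
  exact (Measure.quasiMeasurePreserving_eval (fun _ : Fin n => (volume : Measure ℂ)) j).ae h

theorem norm_laurentMonomial_eq_exp (β : Fin n → ℤ) {z : Fin n → ℂ} (hz : ∀ j, z j ≠ 0) :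
    ‖laurentMonomial β z‖ = Real.exp (∑ j, β j * Real.log ‖z j‖) := by
  rw [norm_laurentMonomial, Real.exp_sum]
  refine Finset.prod_congr rfl fun j _ => ?_
  rw [mul_comm, Real.exp_mul, Real.exp_log (norm_pos_iff.2 (hz j)), Real.rpow_intCast]

/-- Exponents add also at `z = 0`, as long as none of them is negative there; the junk value
`0 ^ (-1) = 0` would break this identity. -/
theorem zpow_add_sum_mul {z : ℂ} {a : ℤ} {b : Fin n → ℤ} (ha : a < 0 → z ≠ 0)
    (hb : ∀ k, b k < 0 → z ≠ 0) (γ : Fin n → ℕ) :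
    z ^ (a + ∑ k, γ k * b k) = z ^ a * ∏ k, (z ^ b k) ^ γ k := by
  rcases eq_or_ne z 0 with rfl | hz
  · have ha' : 0 ≤ a := not_lt.1 fun h => ha h rfl
    have hb' : ∀ k, 0 ≤ b k := fun k => not_lt.1 fun h => hb k h rfl
    lift a to ℕ using ha'
    lift b to Fin n → ℕ using hb'
    simp only [zpow_natCast]
    rw [← Finset.prod_congr rfl fun k _ => pow_mul (0 : ℂ) (b k) (γ k),
      Finset.prod_pow_eq_pow_sum, ← pow_add, ← zpow_natCast]
    congr 1
    push_cast
    congr 1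
    exact Finset.sum_congr rfl fun k _ => mul_comm _ _
  · rw [zpow_add₀ hz]
    congr 1
    induction (Finset.univ : Finset (Fin n)) using Finset.cons_induction with
    | empty => simp
    | cons k s hk ih =>
      rw [Finset.sum_cons, Finset.prod_cons, zpow_add₀ hz, ih, mul_comm, mul_comm (γ k : ℤ),
        zpow_mul, zpow_natCast, mul_comm]

theorem laurentMonomial_add_sum {α : Fin n → Fin n → ℤ} {β : Fin n → ℤ} {z : Fin n → ℂ}
    (hβ : DefinedAt β z) (hα : ∀ k, DefinedAt (α k) z) (γ : Fin n → ℕ) :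
    laurentMonomial (fun j => β j + ∑ k, γ k * α k j) z =
      laurentMonomial β z * ∏ k, laurentMonomial (α k) z ^ γ k := by
  simp only [laurentMonomial]
  rw [Finset.prod_congr rfl fun j _ => zpow_add_sum_mul (hβ j) (fun k => hα k j) γ,
    Finset.prod_mul_distrib, Finset.prod_comm]
  congr 1
  exact Finset.prod_congr rfl fun k _ => Finset.prod_pow _ _ _

/-! ### The twisting map -/

theorem norm_twist {p : ℝ} (hp : 1 < p) (w : Fin n → ℂ) (j : Fin n) :
    ‖twist p w j‖ = ‖w j‖ ^ (p - 1) := by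
  rw [twist, norm_mul, Complex.norm_real, Real.norm_of_nonneg (by positivity)]
  rcases eq_or_ne (w j) 0 with h | h
  · rw [h, norm_zero, Real.zero_rpow (by linarith : p - 1 ≠ 0), zero_mul]
  · have h' : 0 < ‖w j‖ := norm_pos_iff.2 h
    rw [mul_comm, ← Real.rpow_add_one h'.ne']
    congr 1
    ring

theorem definedAt_twist {p : ℝ} (hp : 1 < p) (β : Fin n → ℤ) (w : Fin n → ℂ) :
    DefinedAt β (twist p w) ↔ DefinedAt β w := by
  refine forall₂_congr fun j _ => not_congr ?_
  rw [← norm_eq_zero, norm_twist hp, Real.rpow_eq_zero (norm_nonneg _) (by linarith),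
    norm_eq_zero]

theorem norm_laurentMonomial_twist {p : ℝ} (hp : 1 < p) (β : Fin n → ℤ) (w : Fin n → ℂ) :
    ‖laurentMonomial β (twist p w)‖ = ‖laurentMonomial β w‖ ^ (p - 1) := by
  rw [norm_laurentMonomial, norm_laurentMonomial, ← Real.finsetProd_rpow _ _
    fun j _ => by positivity]
  refine Finset.prod_congr rfl fun j _ => ?_
  rw [norm_twist hp, ← Real.rpow_intCast, ← Real.rpow_mul (norm_nonneg _), mul_comm,
    Real.rpow_mul (norm_nonneg _), Real.rpow_intCast]

theorem twist_rotate (p : ℝ) (θ : UnitAddTorus (Fin n)) (w : Fin n → ℂ) :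
    twist p (rotate θ w) = rotate θ (twist p w) := by
  ext j
  rw [twist, norm_rotate, rotate, rotate, twist, mul_assoc]

@[fun_prop]
theorem measurable_twist (p : ℝ) : Measurable (twist (n := n) p) := by
  refine measurable_pi_lambda _ fun j => ?_
  have h : Measurable fun w : Fin n → ℂ => ‖w j‖ ^ (p - 2) := by fun_prop
  exact (measurable_pi_apply j).mul (Complex.measurable_ofReal.comp h)

/-! ### The logarithmic image of a monomial polyhedron -/

/-- The set `{|e_{α¹}| < 1, …, |e_{αⁿ}| < 1}` defined by the Laurent monomials with exponents
`α k`. -/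
def polyhedron (α : Fin n → Fin n → ℤ) : Set (Fin n → ℂ) :=
  {z | ∀ k, DefinedAt (α k) z ∧ ‖laurentMonomial (α k) z‖ < 1}

/-- The real matrix whose `k`-th row is the exponent `α k`. -/
def exponentMatrix (α : Fin n → Fin n → ℤ) : Matrix (Fin n) (Fin n) ℝ :=
  (Matrix.of α).map Int.cast

theorem exponentMatrix_mulVec_log {z : Fin n → ℂ} (k : Fin n) :
    (exponentMatrix α).mulVec (fun j => Real.log ‖z j‖) k = ∑ j, α k j * Real.log ‖z j‖ := rfl

theorem mem_polyhedron_iff {z : Fin n → ℂ} (hz : ∀ j, z j ≠ 0) :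
    z ∈ polyhedron α ↔ ∀ k, (exponentMatrix α).mulVec (fun j => Real.log ‖z j‖) k < 0 := by
  refine forall_congr' fun k => ?_
  rw [norm_laurentMonomial_eq_exp _ hz, Real.exp_lt_one_iff, exponentMatrix_mulVec_log]
  exact and_iff_right fun j _ => hz j

theorem exp_mem_polyhedron_iff (x : Fin n → ℝ) :
    (fun j => (Real.exp (x j) : ℂ)) ∈ polyhedron α ↔
      ∀ k, (exponentMatrix α).mulVec x k < 0 := by
  rw [mem_polyhedron_iff fun j => by exact_mod_cast (Real.exp_pos _).ne']
  simp only [Complex.norm_real, Real.norm_of_nonneg (Real.exp_pos _).le, Real.log_exp]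

theorem rotate_mem_polyhedron_iff (θ : UnitAddTorus (Fin n)) (w : Fin n → ℂ) :
    rotate θ w ∈ polyhedron α ↔ w ∈ polyhedron α := by
  simp only [polyhedron, Set.mem_ofPred_eq, definedAt_rotate, norm_laurentMonomial_rotate]

/-- The logarithmic image of a bounded polyhedron is bounded above in each coordinate. -/
theorem exists_forall_le_of_isBounded (hb : Bornology.IsBounded (polyhedron α)) :
    ∃ R : ℝ, ∀ x : Fin n → ℝ, (∀ k, (exponentMatrix α).mulVec x k < 0) → ∀ j, x j ≤ R := by
  obtain ⟨R, hR⟩ := hb.exists_norm_le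
  refine ⟨R, fun x hx j => ?_⟩
  have h1 := hR _ ((exp_mem_polyhedron_iff x).2 hx)
  have h2 := (norm_le_pi_norm _ j).trans h1
  rw [Complex.norm_real, Real.norm_of_nonneg (Real.exp_pos _).le] at h2
  linarith [Real.add_one_le_exp (x j)]

theorem exists_mem_forall_ne_zero (ho : IsOpen (polyhedron α)) (hne : (polyhedron α).Nonempty) :
    ∃ z ∈ polyhedron α, ∀ j, z j ≠ 0 := by
  have h1 : ∃ᵐ z : Fin n → ℂ, z ∈ polyhedron α :=
    frequently_ae_mem_iff.2 (ho.measure_pos volume hne).ne'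
  exact (h1.and_eventually ae_forall_ne_zero).exists

/-- A kernel vector of the exponent matrix would be a direction in which the logarithmic image is
translation invariant, which boundedness excludes. -/
theorem det_exponentMatrix_ne_zero (ho : IsOpen (polyhedron α)) (hne : (polyhedron α).Nonempty)
    (hb : Bornology.IsBounded (polyhedron α)) : (exponentMatrix α).det ≠ 0 := by
  intro hdet
  obtain ⟨v, hv0, hv⟩ := Matrix.exists_mulVec_eq_zero_iff.2 hdet
  obtain ⟨z, hz, hz0⟩ := exists_mem_forall_ne_zero ho hne
  obtain ⟨R, hR⟩ := exists_forall_le_of_isBounded hb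
  obtain ⟨j, hj⟩ := Function.ne_iff.1 hv0
  have hj' : v j ≠ 0 := hj
  set x : Fin n → ℝ := fun j => Real.log ‖z j‖ with hx
  -- this translate has `j`-th coordinate `R + 1`
  have h := hR (x + ((R - x j + 1) / v j) • v) (fun k => by
    rw [Matrix.mulVec_add, Matrix.mulVec_smul, hv, smul_zero, add_zero]
    exact (mem_polyhedron_iff hz0).1 hz k) j
  simp only [Pi.add_apply, Pi.smul_apply, smul_eq_mul] at h
  rw [div_mul_cancel₀ _ hj'] at h
  linarith

/-- The logarithmic image is the open cone `{-B y : y > 0}`, where `B` is the inverse of the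
exponent matrix. A cone that is bounded above in each coordinate lies in the negative orthant,
whence `B ≥ 0`. -/
theorem inv_exponentMatrix_nonneg (hdet : (exponentMatrix α).det ≠ 0)
    (hb : Bornology.IsBounded (polyhedron α)) (j k : Fin n) : 0 ≤ (exponentMatrix α)⁻¹ j k := by
  obtain ⟨R, hR⟩ := exists_forall_le_of_isBounded hb
  set B := (exponentMatrix α)⁻¹ with hB
  have hu : IsUnit (exponentMatrix α).det := isUnit_iff_ne_zero.2 hdet
  -- every positive vector `y` gives a point `-t • B y` of the logarithmic image for all `t > 0`
  have h1 : ∀ y : Fin n → ℝ, (∀ k, 0 < y k) → 0 ≤ B.mulVec y j := by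
    intro y hy
    by_contra! hneg
    have ht : 0 < (|R| + 1) / (-B.mulVec y j) := by
      have : 0 < -B.mulVec y j := by linarith
      positivity
    have h := hR (-((|R| + 1) / (-B.mulVec y j)) • B.mulVec y) (fun k => by
      rw [Matrix.mulVec_smul, hB, Matrix.mulVec_mulVec, Matrix.mul_nonsing_inv _ hu,
        Matrix.one_mulVec, Pi.smul_apply, smul_eq_mul, neg_mul, neg_lt_zero]
      exact mul_pos ht (hy k)) j
    rw [Pi.smul_apply, smul_eq_mul, div_neg, neg_neg, div_mul_cancel₀ _ hneg.ne] at h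
    linarith [le_abs_self R]
  -- `B j k` itself is the limiting case where `y` is a basis vector
  have h2 : ∀ ε : ℝ, 0 < ε → 0 ≤ B j k + ε * ∑ i, B j i := by
    intro ε hε
    have := h1 (Pi.single k 1 + fun _ => ε) (fun i => by
      have : 0 ≤ (Pi.single k 1 : Fin n → ℝ) i := by
        by_cases h : i = k
        · subst h; simp
        · simp [h]
      simpa using by linarith)
    rw [Matrix.mulVec_add] at this
    simpa [Matrix.mulVec, dotProduct, Finset.mul_sum, mul_comm] using this
  have hlim : Filter.Tendsto (fun ε : ℝ => B j k + ε * ∑ i, B j i) (nhdsWithin 0 (Set.Ioi 0))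
      (nhds (B j k)) := by
    have : Filter.Tendsto (fun ε : ℝ => B j k + ε * ∑ i, B j i) (nhds 0)
      (nhds (B j k + 0 * ∑ i, B j i)) := by
      apply Continuous.tendsto
      fun_prop
    rw [zero_mul, add_zero] at this
    exact this.mono_left nhdsWithin_le_nhds
  exact ge_of_tendsto hlim (Filter.eventually_of_mem self_mem_nhdsWithin h2)

/-- If the polyhedron meets `{z j = 0}`, then some column of the inverse exponent matrix is a
positive multiple of the `j`-th basis vector: column `j` of the exponent matrix is nonnegative,
and it writes that basis vector as a nonnegative combination of nonnegative columns. -/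
theorem exists_column_of_mem {z : Fin n → ℂ} (hz : z ∈ polyhedron α) {j : Fin n}
    (hj : z j = 0) (hdet : (exponentMatrix α).det ≠ 0)
    (hB : ∀ i k, 0 ≤ (exponentMatrix α)⁻¹ i k) :
    ∃ k, 0 < (exponentMatrix α)⁻¹ j k ∧ ∀ i, i ≠ j → (exponentMatrix α)⁻¹ i k = 0 := by
  have hu : IsUnit (exponentMatrix α).det := isUnit_iff_ne_zero.2 hdet
  have hA : ∀ k, 0 ≤ exponentMatrix α k j := fun k => by
    change (0 : ℝ) ≤ ((α k j : ℤ) : ℝ)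
    exact_mod_cast not_lt.1 fun h => (hz k).1 j h hj
  have hI : ∀ i, ∑ k, (exponentMatrix α)⁻¹ i k * exponentMatrix α k j =
      (1 : Matrix (Fin n) (Fin n) ℝ) i j := fun i => by
    rw [← Matrix.mul_apply, Matrix.nonsing_inv_mul _ hu]
  obtain ⟨k, -, hk⟩ : ∃ k ∈ Finset.univ, 0 < (exponentMatrix α)⁻¹ j k * exponentMatrix α k j := by
    refine Finset.exists_lt_of_sum_lt ?_
    rw [hI j]
    simp
  have hk2 : 0 < exponentMatrix α k j := by
    refine lt_of_le_of_ne (hA k) fun h => ?_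
    rw [← h, mul_zero] at hk
    exact hk.false
  refine ⟨k, pos_of_mul_pos_left hk hk2.le, fun i hij => ?_⟩
  have h0 := hI i
  rw [Matrix.one_apply_ne hij, Finset.sum_eq_zero_iff_of_nonneg
    fun k _ => mul_nonneg (hB i k) (hA k)] at h0
  exact (mul_eq_zero.1 (h0 k (Finset.mem_univ k))).resolve_right hk2.ne'

/-! ### Integration over a monomial polyhedron -/

/-- The numbers `weight α β k` express `|e_β|` through the defining monomials:
`|e_β| = ∏ k, |e_{α k}| ^ weight α β k` off the coordinate hyperplanes. -/
def weight (α : Fin n → Fin n → ℤ) (β : Fin n → ℤ) : Fin n → ℝ :=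
  Matrix.vecMul (fun j => (β j : ℝ)) (exponentMatrix α)⁻¹

/-- The exponents of the defining monomials in the volume density: off the coordinate hyperplanes,
`|z₁ ⋯ zₙ|² = ∏ k, |e_{α k}| ^ volumeWeight α k`. -/
def volumeWeight (α : Fin n → Fin n → ℤ) (k : Fin n) : ℝ :=
  2 * ∑ j, (exponentMatrix α)⁻¹ j k

/-- The coordinates `-log |e_{α k}(z)|`, defined linearly from the `log |z j|`. They are meaningful
off the coordinate hyperplanes, where they are positive exactly on the polyhedron. -/
def level (α : Fin n → Fin n → ℤ) (z : Fin n → ℂ) (k : Fin n) : ℝ :=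
  -(exponentMatrix α).mulVec (fun j => Real.log ‖z j‖) k

theorem norm_laurentMonomial_eq_exp_level {z : Fin n → ℂ} (hz : ∀ j, z j ≠ 0) (k : Fin n) :
    ‖laurentMonomial (α k) z‖ = Real.exp (-level α z k) := by
  rw [norm_laurentMonomial_eq_exp _ hz, level, neg_neg, exponentMatrix_mulVec_log]

theorem weight_apply (β : Fin n → ℤ) (k : Fin n) :
    weight α β k = ∑ j, β j * (exponentMatrix α)⁻¹ j k := rfl

theorem sum_weight_mul (hdet : (exponentMatrix α).det ≠ 0) (β : Fin n → ℤ) (j : Fin n) :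
    ∑ k, weight α β k * α k j = β j := by
  have hu : IsUnit (exponentMatrix α).det := isUnit_iff_ne_zero.2 hdet
  have : Matrix.vecMul (weight α β) (exponentMatrix α) j = β j := by
    rw [weight, Matrix.vecMul_vecMul, Matrix.nonsing_inv_mul _ hu, Matrix.vecMul_one]
  exact this

theorem weight_add_sum (hdet : (exponentMatrix α).det ≠ 0) (β : Fin n → ℤ) (γ : Fin n → ℤ)
    (k : Fin n) :
    weight α (fun j => β j + ∑ i, γ i * α i j) k = weight α β k + γ k := by
  have hu : IsUnit (exponentMatrix α).det := isUnit_iff_ne_zero.2 hdet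
  have h1 : (fun j => ((β j + ∑ i, γ i * α i j : ℤ) : ℝ)) =
      (fun j => (β j : ℝ)) + Matrix.vecMul (fun i => (γ i : ℝ)) (exponentMatrix α) := by
    ext j
    simp [Matrix.vecMul, dotProduct, exponentMatrix]
  rw [weight, h1, Matrix.add_vecMul, Matrix.vecMul_vecMul, Matrix.mul_nonsing_inv _ hu,
    Matrix.vecMul_one]
  rfl

theorem norm_laurentMonomial_eq_prod (hdet : (exponentMatrix α).det ≠ 0) (β : Fin n → ℤ)
    {z : Fin n → ℂ} (hz : ∀ j, z j ≠ 0) :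
    ‖laurentMonomial β z‖ = ∏ k, Real.exp (-(weight α β k * level α z k)) := by
  rw [norm_laurentMonomial_eq_exp _ hz, ← Real.exp_sum]
  congr 1
  simp only [level, mul_neg, neg_neg, exponentMatrix_mulVec_log]
  simp_rw [Finset.mul_sum]
  rw [Finset.sum_comm]
  refine Finset.sum_congr rfl fun j _ => ?_
  rw [← sum_weight_mul hdet β j, Finset.sum_mul]
  exact Finset.sum_congr rfl fun k _ => by ring

theorem ae_mem_polyhedron_iff :
    ∀ᵐ z : Fin n → ℂ, z ∈ polyhedron α ↔ ∀ k, 0 < level α z k := by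
  filter_upwards [ae_forall_ne_zero] with z hz
  rw [mem_polyhedron_iff hz]
  simp only [level, neg_pos]

/-- The constant in the volume formula `setLIntegral_prod_level`. -/
def volumeConst (α : Fin n → Fin n → ℤ) : ℝ :=
  (2 * Real.pi) ^ n * |(exponentMatrix α).det|⁻¹

theorem volumeConst_pos (hdet : (exponentMatrix α).det ≠ 0) : 0 < volumeConst α := by
  have := abs_pos.2 hdet
  unfold volumeConst
  positivity

/-- Integration of a product of functions of the individual `|e_{α k}|` over the polyhedron. -/
theorem setLIntegral_prod_level (hdet : (exponentMatrix α).det ≠ 0)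
    (hU : MeasurableSet (polyhedron α)) {h : Fin n → ℝ → ℝ≥0∞} (hh : ∀ k, Measurable (h k)) :
    ∫⁻ z in polyhedron α, ∏ k, h k (level α z k) = ENNReal.ofReal (volumeConst α) *
      ∏ k, ∫⁻ y in Set.Ioi 0, h k y * ENNReal.ofReal (Real.exp (-(volumeWeight α k * y))) := by
  have key := lintegral_prod_comp_mulVec_log (isUnit_iff_ne_zero.2 hdet)
    (h := fun k => (Set.Ioi 0).indicator (h k)) fun k => (hh k).indicator measurableSet_Ioi
  rw [← lintegral_indicator hU]
  convert key using 1
  · refine lintegral_congr_ae ?_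
    filter_upwards [ae_mem_polyhedron_iff (α := α)] with z hz
    change _ = ∏ k, (Set.Ioi 0).indicator (h k) (level α z k)
    by_cases hzU : z ∈ polyhedron α
    · rw [Set.indicator_of_mem hzU]
      exact Finset.prod_congr rfl fun k _ => (Set.indicator_of_mem (hz.1 hzU k) _).symm
    · rw [Set.indicator_of_notMem hzU]
      rw [hz, not_forall] at hzU
      obtain ⟨k, hk⟩ := hzU
      exact (Finset.prod_eq_zero (Finset.mem_univ k) (Set.indicator_of_notMem hk _)).symm
  · congr 1
    refine Finset.prod_congr rfl fun k _ => ?_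
    rw [← lintegral_indicator measurableSet_Ioi]
    refine lintegral_congr fun y => ?_
    rw [Set.indicator_mul_left]
    rfl

theorem lintegral_exp_neg_mul_Ioi (t : ℝ) :
    ∫⁻ y in Set.Ioi (0 : ℝ), ENNReal.ofReal (Real.exp (-(t * y))) =
      if 0 < t then ENNReal.ofReal t⁻¹ else ∞ := by
  split_ifs with ht
  · have hint : IntegrableOn (fun y => Real.exp (-(t * y))) (Set.Ioi 0) := by
      simpa only [neg_mul] using exp_neg_integrableOn_Ioi 0 ht
    rw [← ofReal_integral_eq_lintegral_ofReal hint (ae_of_all _ fun y => (Real.exp_pos _).le)]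
    have := integral_exp_mul_Ioi (neg_lt_zero.2 ht) 0
    simp only [neg_mul, mul_zero, Real.exp_zero] at this
    rw [this, neg_div_neg_eq, one_div]
  · rw [eq_top_iff]
    calc ∞ = ∫⁻ y in Set.Ioi (0 : ℝ), 1 := by simp
      _ ≤ _ := setLIntegral_mono' measurableSet_Ioi fun y hy => by
        rw [ENNReal.one_le_ofReal]
        exact Real.one_le_exp (by nlinarith [Set.mem_Ioi.1 hy])

theorem setLIntegral_norm_laurentMonomial_rpow (hdet : (exponentMatrix α).det ≠ 0)
    (hU : MeasurableSet (polyhedron α)) (β : Fin n → ℤ) (p : ℝ) :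
    ∫⁻ z in polyhedron α, ENNReal.ofReal (‖laurentMonomial β z‖ ^ p) =
      ENNReal.ofReal (volumeConst α) *
        ∏ k, if 0 < p * weight α β k + volumeWeight α k then
          ENNReal.ofReal (p * weight α β k + volumeWeight α k)⁻¹ else ∞ := by
  simp_rw [← lintegral_exp_neg_mul_Ioi]
  have h := setLIntegral_prod_level hdet hU
    (h := fun k y => ENNReal.ofReal (Real.exp (-(p * weight α β k * y)))) fun k => by fun_prop
  convert h using 1
  · refine lintegral_congr_ae ?_
    filter_upwards [ae_restrict_of_ae ae_forall_ne_zero] with z hz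
    rw [norm_laurentMonomial_eq_prod hdet β hz, ← ENNReal.ofReal_prod_of_nonneg
      fun k _ => (Real.exp_pos _).le, ← Real.finsetProd_rpow _ _ fun k _ => (Real.exp_pos _).le]
    congr 1
    refine Finset.prod_congr rfl fun k _ => ?_
    rw [← Real.exp_mul]
    congr 1
    ring
  · congr 1
    refine Finset.prod_congr rfl fun k _ => lintegral_congr fun y => ?_
    rw [← ENNReal.ofReal_mul (Real.exp_pos _).le, ← Real.exp_add]
    congr 2
    ring

theorem memLp_laurentMonomial_iff (hdet : (exponentMatrix α).det ≠ 0)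
    (hU : MeasurableSet (polyhedron α)) (β : Fin n → ℤ) {p : ℝ} (hp : 0 < p) :
    MemLp (laurentMonomial β) (ENNReal.ofReal p) (volume.restrict (polyhedron α)) ↔
      ∀ k, 0 < p * weight α β k + volumeWeight α k := by
  have hm : AEStronglyMeasurable (laurentMonomial β) (volume.restrict (polyhedron α)) :=
    (measurable_laurentMonomial β).aestronglyMeasurable
  rw [MemLp, and_iff_right hm, eLpNorm_lt_top_iff_lintegral_rpow_enorm_lt_top
    (by simpa using hp) ENNReal.ofReal_ne_top, ENNReal.toReal_ofReal hp.le]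
  have : ∀ z, ‖laurentMonomial β z‖ₑ ^ p = ENNReal.ofReal (‖laurentMonomial β z‖ ^ p) := fun z => by
    rw [← ENNReal.ofReal_rpow_of_nonneg (norm_nonneg _) hp.le, ofReal_norm]
  simp_rw [this]
  rw [setLIntegral_norm_laurentMonomial_rpow hdet hU]
  constructor
  · intro h k
    by_contra hk
    refine h.ne (ENNReal.mul_eq_top.2 (Or.inl ⟨?_, ?_⟩))
    · simpa using volumeConst_pos hdet
    · -- no factor vanishes, so a single infinite one makes the product infinite
      rw [← Finset.mul_prod_erase _ _ (Finset.mem_univ k), if_neg hk, ENNReal.top_mul]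
      refine Finset.prod_ne_zero_iff.2 fun i _ => ?_
      split_ifs with hi
      · simpa using hi
      · exact ENNReal.top_ne_zero
  · intro h
    refine ENNReal.mul_lt_top ENNReal.ofReal_lt_top (ENNReal.prod_lt_top fun k _ => ?_)
    rw [if_pos (h k)]
    exact ENNReal.ofReal_lt_top

theorem monomialNormPow_polyhedron (hdet : (exponentMatrix α).det ≠ 0)
    (hU : MeasurableSet (polyhedron α)) (β : Fin n → ℤ) (p : ℝ)
    (h : ∀ k, 0 < p * weight α β k + volumeWeight α k) :
    monomialNormPow p (polyhedron α) β =
      volumeConst α * ∏ k, (p * weight α β k + volumeWeight α k)⁻¹ := by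
  rw [monomialNormPow, integral_eq_lintegral_of_nonneg_ae (ae_of_all _ fun z => by positivity)
    (by exact (by fun_prop : Measurable fun z => ‖laurentMonomial β z‖ ^ p).aestronglyMeasurable),
    setLIntegral_norm_laurentMonomial_rpow hdet hU]
  simp_rw [if_pos (h _)]
  rw [← ENNReal.ofReal_prod_of_nonneg fun k _ => (inv_pos.2 (h k)).le,
    ← ENNReal.ofReal_mul (volumeConst_pos hdet).le, ENNReal.toReal_ofReal]
  exact mul_nonneg (volumeConst_pos hdet).le (Finset.prod_nonneg fun k _ => (inv_pos.2 (h k)).le)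

/-! ### Allowable indices -/

/-- Openness of the polyhedron, together with the consequences of boundedness used below: the
exponent matrix is invertible, and its inverse has nonnegative entries. -/
structure IsAdmissible (α : Fin n → Fin n → ℤ) : Prop where
  isOpen : IsOpen (polyhedron α)
  det_ne_zero : (exponentMatrix α).det ≠ 0
  inv_nonneg : ∀ j k, 0 ≤ (exponentMatrix α)⁻¹ j k

theorem isAdmissible_of_isBounded (ho : IsOpen (polyhedron α)) (hne : (polyhedron α).Nonempty)
    (hb : Bornology.IsBounded (polyhedron α)) : IsAdmissible α :=
  have hdet := det_exponentMatrix_ne_zero ho hne hb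
  ⟨ho, hdet, inv_exponentMatrix_nonneg hdet hb⟩

/-- Column `k` of the inverse exponent matrix points along a coordinate axis `j` whose hyperplane
`{z j = 0}` meets the polyhedron. For such `k` the sign of `weight α β k` is that of `β j`. -/
def IsAxisIndex (α : Fin n → Fin n → ℤ) (k : Fin n) : Prop :=
  ∃ j, (∃ z ∈ polyhedron α, z j = 0) ∧ 0 < (exponentMatrix α)⁻¹ j k ∧
    ∀ i, i ≠ j → (exponentMatrix α)⁻¹ i k = 0

/-- The up-set of real numbers that the `k`-th weight of an allowable index has to belong to: the
first condition is integrability, the second one says that the monomial is defined. -/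
def allowableWeights (p : ℝ) (α : Fin n → Fin n → ℤ) (k : Fin n) : Set ℝ :=
  {x | 0 < p * x + volumeWeight α k ∧ (IsAxisIndex α k → 0 ≤ x)}

theorem weight_eq_of_column {j k : Fin n} (h : ∀ i, i ≠ j → (exponentMatrix α)⁻¹ i k = 0)
    (β : Fin n → ℤ) : weight α β k = β j * (exponentMatrix α)⁻¹ j k := by
  rw [weight_apply]
  exact Finset.sum_eq_single j (fun i _ hi => by rw [h i hi, mul_zero]) (by simp)

/-- Allowability of an index decouples into one condition on each of its weights. -/
theorem mem_allowableIndices_iff (hα : IsAdmissible α) {p : ℝ} (hp : 0 < p) (β : Fin n → ℤ) :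
    β ∈ allowableIndices p (polyhedron α) ↔ ∀ k, weight α β k ∈ allowableWeights p α k := by
  constructor
  · rintro ⟨hd, -, hL⟩ k
    refine ⟨(memLp_laurentMonomial_iff hα.det_ne_zero hα.isOpen.measurableSet β hp).1 hL k, ?_⟩
    rintro ⟨j, ⟨z, hz, hzj⟩, hpos, h0⟩
    rw [weight_eq_of_column h0]
    have : 0 ≤ β j := not_lt.1 fun h => hd z hz j h hzj
    positivity
  · intro h
    have hd : ∀ z ∈ polyhedron α, DefinedAt β z := by
      intro z hz j hβ hzj
      obtain ⟨k, hpos, h0⟩ := exists_column_of_mem hz hzj hα.det_ne_zero hα.inv_nonneg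
      have h1 := (h k).2 ⟨j, ⟨z, hz, hzj⟩, hpos, h0⟩
      rw [weight_eq_of_column h0] at h1
      have h2 : (β j : ℝ) < 0 := by exact_mod_cast hβ
      exact absurd h1 (not_le.2 (mul_neg_of_neg_of_pos h2 hpos))
    exact ⟨hd, differentiableOn_laurentMonomial hd,
      (memLp_laurentMonomial_iff hα.det_ne_zero hα.isOpen.measurableSet β hp).2 fun k => (h k).1⟩

theorem allowableWeights_mono {p : ℝ} (hp : 0 < p) {k : Fin n} {x y : ℝ} (hxy : x ≤ y)
    (hx : x ∈ allowableWeights p α k) : y ∈ allowableWeights p α k :=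
  ⟨lt_of_lt_of_le hx.1 (by gcongr), fun h => (hx.2 h).trans hxy⟩

/-- The allowable indices that stop being allowable after subtraction of any one of the `α k`. The
allowable indices are the translates of these by nonnegative combinations of the `α k`, in a
unique way; see `indexEquiv`. -/
def fundamentalIndices (p : ℝ) (α : Fin n → Fin n → ℤ) : Set (Fin n → ℤ) :=
  {β | ∀ k, weight α β k ∈ allowableWeights p α k ∧ weight α β k - 1 ∉ allowableWeights p α k}

theorem finite_fundamentalIndices (hα : IsAdmissible α) {p : ℝ} (hp : 0 < p) :
    (fundamentalIndices p α).Finite := by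
  have hw : ∀ β ∈ fundamentalIndices p α, ∀ k,
      |weight α β k| ≤ |volumeWeight α k| / p + 1 := by
    intro β hβ k
    obtain ⟨h1, h2⟩ := hβ k
    have e : -(volumeWeight α k) / p ≤ |volumeWeight α k| / p := by
      gcongr; exact neg_le_abs _
    have l : -(volumeWeight α k) / p < weight α β k := by
      rw [div_lt_iff₀ hp]; linarith [h1.1]
    have l' : -(|volumeWeight α k| / p) ≤ -(volumeWeight α k) / p := by
      rw [← neg_div]; gcongr; exact le_abs_self _
    rw [abs_le]
    refine ⟨by linarith, ?_⟩
    by_contra! hc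
    refine h2 ⟨?_, fun _ => ?_⟩
    · have : |volumeWeight α k| / p < weight α β k - 1 := by linarith
      rw [div_lt_iff₀ hp] at this
      linarith [neg_abs_le (volumeWeight α k)]
    · have : 0 ≤ |volumeWeight α k| / p := by positivity
      linarith
  set N : Fin n → ℤ := fun j => ⌈∑ k, (|volumeWeight α k| / p + 1) * |(α k j : ℝ)|⌉ with hN
  refine (Set.finite_Icc (-N) N).subset fun β hβ => ?_
  have : ∀ j, |β j| ≤ N j := by
    intro j
    have h1 : |(β j : ℝ)| ≤ ∑ k, (|volumeWeight α k| / p + 1) * |(α k j : ℝ)| := by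
      rw [← sum_weight_mul hα.det_ne_zero β j]
      refine (Finset.abs_sum_le_sum_abs _ _).trans (Finset.sum_le_sum fun k _ => ?_)
      rw [abs_mul]
      gcongr
      exact hw β hβ k
    refine Int.cast_le (R := ℝ).1 ?_
    rw [Int.cast_abs]
    exact h1.trans (Int.le_ceil _)
  exact ⟨fun j => (abs_le.1 (this j)).1, fun j => (abs_le.1 (this j)).2⟩

/-- Every element of the up-set can be lowered by a natural number to one at the bottom of it. -/
theorem exists_nat_sub_mem_allowableWeights {p : ℝ} (hp : 0 < p) {k : Fin n} {x : ℝ}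
    (hx : x ∈ allowableWeights p α k) :
    ∃ m : ℕ, x - m ∈ allowableWeights p α k ∧ x - m - 1 ∉ allowableWeights p α k := by
  have hex : ∃ m : ℕ, x - m ∉ allowableWeights p α k := by
    obtain ⟨m, hm⟩ := exists_nat_ge (x + volumeWeight α k / p)
    refine ⟨m, fun h => ?_⟩
    have h1 := h.1
    have h2 : p * (x - m) ≤ p * (-(volumeWeight α k / p)) := by gcongr; linarith
    rw [mul_neg, mul_div_cancel₀ _ hp.ne'] at h2
    linarith
  classical
  have h0 : Nat.find hex ≠ 0 := by
    intro h
    have := Nat.find_spec hex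
    rw [h] at this
    simp [hx] at this
  obtain ⟨m, hm⟩ := Nat.exists_eq_succ_of_ne_zero h0
  refine ⟨m, not_not.1 (Nat.find_min hex (m := m) (by omega)), ?_⟩
  have := Nat.find_spec hex
  rw [hm] at this
  push_cast at this
  rwa [sub_sub]

/-- The lowering in `exists_nat_sub_mem_allowableWeights` is by a unique amount. -/
theorem eq_of_add_eq_add {p : ℝ} (hp : 0 < p) {k : Fin n} {x y : ℝ} {l m : ℕ}
    (hx : x ∈ allowableWeights p α k) (hx' : x - 1 ∉ allowableWeights p α k)
    (hy : y ∈ allowableWeights p α k) (hy' : y - 1 ∉ allowableWeights p α k)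
    (h : x + l = y + m) : l = m := by
  rcases lt_trichotomy l m with hlt | rfl | hlt
  · have : (l : ℝ) + 1 ≤ m := by exact_mod_cast hlt
    exact absurd (allowableWeights_mono hp (by linarith) hy) hx'
  · rfl
  · have : (m : ℝ) + 1 ≤ l := by exact_mod_cast hlt
    exact absurd (allowableWeights_mono hp (by linarith) hx) hy'

/-- The index `β + ∑ k, γ k • α k`. -/
def translate (α : Fin n → Fin n → ℤ) (β : Fin n → ℤ) (γ : Fin n → ℕ) : Fin n → ℤ :=
  fun j => β j + ∑ k, γ k * α k j

theorem weight_translate (hα : IsAdmissible α) (β : Fin n → ℤ) (γ : Fin n → ℕ) (k : Fin n) :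
    weight α (translate α β γ) k = weight α β k + γ k := by
  rw [← Int.cast_natCast (R := ℝ) (γ k)]
  exact weight_add_sum hα.det_ne_zero β (fun k => (γ k : ℤ)) k

theorem translate_mem (hα : IsAdmissible α) {p : ℝ} (hp : 0 < p)
    {β : Fin n → ℤ} (hβ : β ∈ fundamentalIndices p α) (γ : Fin n → ℕ) :
    translate α β γ ∈ allowableIndices p (polyhedron α) := by
  rw [mem_allowableIndices_iff hα hp]
  intro k
  rw [weight_translate hα]
  exact allowableWeights_mono hp (by simp) (hβ k).1

/-- Each allowable index is uniquely a fundamental index plus a nonnegative integer combination of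
the exponents `α k`. -/
def indexEquiv (hα : IsAdmissible α) {p : ℝ} (hp : 0 < p) :
    fundamentalIndices p α × (Fin n → ℕ) ≃ allowableIndices p (polyhedron α) :=
  Equiv.ofBijective (fun x => ⟨translate α x.1 x.2, translate_mem hα hp x.1.2 x.2⟩) <| by
    constructor
    · rintro ⟨⟨β, hβ⟩, γ⟩ ⟨⟨β', hβ'⟩, γ'⟩ h
      have h1 : translate α β γ = translate α β' γ' := congrArg Subtype.val h
      have hγ : γ = γ' := by
        ext k
        have h2 := congrArg (fun b => weight α b k) h1
        simp only [weight_translate hα] at h2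
        exact eq_of_add_eq_add hp (hβ k).1 (hβ k).2 (hβ' k).1 (hβ' k).2 h2
      subst hγ
      have hβ : β = β' := by
        ext j
        exact add_right_cancel (congrFun h1 j)
      subst hβ
      rfl
    · rintro ⟨β, hβ⟩
      rw [mem_allowableIndices_iff hα hp] at hβ
      choose γ hγ hγ' using fun k => exists_nat_sub_mem_allowableWeights hp (hβ k)
      have hw : ∀ k, weight α (fun j => β j + ∑ i, (-(γ i : ℤ)) * α i j) k =
          weight α β k - γ k := fun k => by
        rw [weight_add_sum hα.det_ne_zero]
        push_cast
        ring
      refine ⟨⟨⟨fun j => β j + ∑ i, (-(γ i : ℤ)) * α i j, fun k => ?_⟩, γ⟩, ?_⟩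
      · rw [hw]
        exact ⟨hγ k, hγ' k⟩
      · refine Subtype.ext (funext fun j => ?_)
        simp [translate]

/-! ### The kernel in closed form -/

/-- The sesquilinear monomial `e_β(z) * conj (e_β (χ_p w))`. -/
def twistedProduct (p : ℝ) (β : Fin n → ℤ) (z w : Fin n → ℂ) : ℂ :=
  laurentMonomial β z * conj (laurentMonomial β (twist p w))

theorem norm_twistedProduct {p : ℝ} (hp : 1 < p) (β : Fin n → ℤ) (z w : Fin n → ℂ) :
    ‖twistedProduct p β z w‖ = ‖laurentMonomial β z‖ * ‖laurentMonomial β w‖ ^ (p - 1) := by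
  rw [twistedProduct, norm_mul, RCLike.norm_conj, norm_laurentMonomial_twist hp]

theorem norm_twistedProduct_lt_one {p : ℝ} (hp : 1 < p) {z w : Fin n → ℂ} (hz : z ∈ polyhedron α)
    (hw : w ∈ polyhedron α) (k : Fin n) : ‖twistedProduct p (α k) z w‖ < 1 := by
  rw [norm_twistedProduct hp]
  have h1 : ‖laurentMonomial (α k) w‖ ^ (p - 1) ≤ 1 :=
    Real.rpow_le_one (norm_nonneg _) (hw k).2.le (by linarith)
  exact mul_lt_one_of_nonneg_of_lt_one_left (norm_nonneg _) (hz k).2 h1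

/-- The reciprocal of the `k`-th factor of `‖e_β‖_p^p`; see `monomialNormPow_polyhedron`. -/
def normWeight (p : ℝ) (α : Fin n → Fin n → ℤ) (β : Fin n → ℤ) (k : Fin n) : ℝ :=
  p * weight α β k + volumeWeight α k

theorem kernelTerm_translate (hα : IsAdmissible α) {p : ℝ} (hp : 1 < p)
    {β : Fin n → ℤ} (hβ : β ∈ fundamentalIndices p α) (γ : Fin n → ℕ) {z w : Fin n → ℂ}
    (hz : z ∈ polyhedron α) (hw : w ∈ polyhedron α) :
    kernelTerm p (polyhedron α) z w (translate α β γ) =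
      (volumeConst α : ℂ)⁻¹ * twistedProduct p β z w *
        ∏ k, ((normWeight p α β k + p * γ k : ℝ) : ℂ) * twistedProduct p (α k) z w ^ γ k := by
  have hp0 : 0 < p := by linarith
  have hβS : β ∈ allowableIndices p (polyhedron α) :=
    (mem_allowableIndices_iff hα hp0 β).2 fun k => (hβ k).1
  have hpos : ∀ k, 0 < p * weight α (translate α β γ) k + volumeWeight α k := fun k =>
    ((mem_allowableIndices_iff hα hp0 _).1 (translate_mem hα hp0 hβ γ) k).1
  have hnw : ∀ k, p * weight α (translate α β γ) k + volumeWeight α k =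
      normWeight p α β k + p * γ k := fun k => by
    rw [weight_translate hα, normWeight]; ring
  have e1 : laurentMonomial (translate α β γ) z = _ :=
    laurentMonomial_add_sum (hβS.1 z hz) (fun k => (hz k).1) γ
  have e2 : laurentMonomial (translate α β γ) (twist p w) = _ :=
    laurentMonomial_add_sum ((definedAt_twist hp β w).2 (hβS.1 w hw))
      (fun k => (definedAt_twist hp _ w).2 (hw k).1) γ
  rw [kernelTerm, monomialNormPow_polyhedron hα.det_ne_zero hα.isOpen.measurableSet _ _ hpos,
    e1, e2]
  simp_rw [hnw, twistedProduct, mul_pow, Finset.prod_mul_distrib]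
  rw [map_mul, map_prod]
  simp_rw [map_pow]
  push_cast
  rw [Finset.prod_inv_distrib]
  rw [div_eq_mul_inv, mul_inv, inv_inv]
  ring

theorem summable_kernelTerm (hα : IsAdmissible α) {p : ℝ} (hp : 1 < p) {z w : Fin n → ℂ}
    (hz : z ∈ polyhedron α) (hw : w ∈ polyhedron α) :
    Summable fun β : allowableIndices p (polyhedron α) =>
      kernelTerm p (polyhedron α) z w (β : Fin n → ℤ) := by
  have hp0 : 0 < p := by linarith
  have hfin := (finite_fundamentalIndices hα hp0).to_subtype
  rw [← (indexEquiv hα hp0).summable_iff]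
  refine Summable.of_norm ((summable_prod_of_nonneg fun _ => norm_nonneg _).2
    ⟨fun β => ?_, Summable.of_finite⟩)
  have h := (summable_and_tsum_pi_prod (fun k m => ((normWeight p α β k + p * m : ℝ) : ℂ) *
    twistedProduct p (α k) z w ^ m) fun k =>
      summable_norm_affine_mul_pow _ _ (norm_twistedProduct_lt_one hp hz hw k)).1
  refine (h.mul_left ‖(volumeConst α : ℂ)⁻¹ * twistedProduct p β z w‖).congr fun γ => ?_
  rw [← norm_mul]
  exact (congrArg norm (kernelTerm_translate hα hp β.2 γ hz hw)).symm

/-- The sum of the kernel terms over all translates of `β`, in closed form. -/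
def closedKernel (p : ℝ) (α : Fin n → Fin n → ℤ) (β : Fin n → ℤ) (z w : Fin n → ℂ) : ℂ :=
  (volumeConst α : ℂ)⁻¹ * twistedProduct p β z w *
    ∏ k, ((normWeight p α β k + (p - normWeight p α β k) * twistedProduct p (α k) z w) /
      (1 - twistedProduct p (α k) z w) ^ 2)

theorem monomialBasisKernel_eq_tsum (hα : IsAdmissible α) {p : ℝ} (hp : 1 < p) {z w : Fin n → ℂ}
    (hz : z ∈ polyhedron α) (hw : w ∈ polyhedron α) :
    monomialBasisKernel p (polyhedron α) z w =
      ∑' β : fundamentalIndices p α, closedKernel p α β z w := by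
  have hp0 : 0 < p := by linarith
  have hs := (indexEquiv hα hp0).summable_iff.2 (summable_kernelTerm hα hp hz hw)
  rw [monomialBasisKernel, ← (indexEquiv hα hp0).tsum_eq]
  refine hs.tsum_prod.trans ?_
  refine tsum_congr fun β => ?_
  have h := (summable_and_tsum_pi_prod (fun k m => ((normWeight p α β k + p * m : ℝ) : ℂ) *
    twistedProduct p (α k) z w ^ m) fun k =>
      summable_norm_affine_mul_pow _ _ (norm_twistedProduct_lt_one hp hz hw k)).2
  refine (tsum_congr fun γ => kernelTerm_translate hα hp β.2 γ hz hw).trans ?_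
  rw [tsum_mul_left, h, closedKernel]
  congr 1
  exact Finset.prod_congr rfl fun k _ =>
    tsum_affine_mul_pow _ _ (norm_twistedProduct_lt_one hp hz hw k)

/-- The product of moduli that dominates `closedKernel`, up to a constant. -/
def majorant (p : ℝ) (α : Fin n → Fin n → ℤ) (β : Fin n → ℤ) (z w : Fin n → ℂ) : ℝ :=
  ‖laurentMonomial β z‖ * ‖laurentMonomial β w‖ ^ (p - 1) *
    ∏ k, (‖1 - twistedProduct p (α k) z w‖ ^ 2)⁻¹

theorem norm_closedKernel_le (hα : IsAdmissible α) {p : ℝ} (hp : 1 < p) (β : Fin n → ℤ)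
    {z w : Fin n → ℂ} (hz : z ∈ polyhedron α) (hw : w ∈ polyhedron α) :
    ‖closedKernel p α β z w‖ ≤ (volumeConst α)⁻¹ *
      (∏ k, (|normWeight p α β k| + |p - normWeight p α β k|)) * majorant p α β z w := by
  have hc := volumeConst_pos hα.det_ne_zero
  rw [closedKernel, norm_mul, norm_mul, norm_prod, norm_inv, Complex.norm_real,
    Real.norm_of_nonneg hc.le, norm_twistedProduct hp, majorant]
  have h : ∏ k, ‖(normWeight p α β k + (p - normWeight p α β k) * twistedProduct p (α k) z w) /
      (1 - twistedProduct p (α k) z w) ^ 2‖ ≤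
      (∏ k, (|normWeight p α β k| + |p - normWeight p α β k|)) *
        ∏ k, (‖1 - twistedProduct p (α k) z w‖ ^ 2)⁻¹ := by
    rw [← Finset.prod_mul_distrib]
    refine Finset.prod_le_prod (fun _ _ => norm_nonneg _) fun k _ => ?_
    rw [norm_div, norm_pow, div_eq_mul_inv]
    gcongr
    refine (norm_add_le _ _).trans ?_
    rw [norm_mul, Complex.norm_real, Real.norm_eq_abs, ← Complex.ofReal_sub, Complex.norm_real,
      Real.norm_eq_abs]
    gcongr
    exact mul_le_of_le_one_right (abs_nonneg _) (norm_twistedProduct_lt_one hp hz hw k).le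
  calc _ ≤ (volumeConst α)⁻¹ * (‖laurentMonomial β z‖ * ‖laurentMonomial β w‖ ^ (p - 1)) *
        ((∏ k, (|normWeight p α β k| + |p - normWeight p α β k|)) *
          ∏ k, (‖1 - twistedProduct p (α k) z w‖ ^ 2)⁻¹) := by gcongr
    _ = _ := by ring

/-! ### Schur estimates for the kernel -/

theorem det_of_exponents_ne_zero (h : (exponentMatrix α).det ≠ 0) : (Matrix.of α).det ≠ 0 := by
  intro h0
  apply h
  have := Int.cast_det (R := ℝ) (Matrix.of α)
  rw [exponentMatrix]
  exact this.symm.trans (by rw [h0, Int.cast_zero])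

/-- Torus averaging: against a rotation invariant weight, the oscillating product of the
`|1 - d k * conj (E k w)|⁻²` may be replaced by the product of the `1 / (1 - |d k|² |E k w|²)`. -/
theorem setLIntegral_mul_prod_inv_sq (hα : IsAdmissible α) {φ : (Fin n → ℂ) → ℝ≥0∞}
    (hφ : Measurable φ) (hφr : ∀ θ w, φ (rotate θ w) = φ w) {E : Fin n → (Fin n → ℂ) → ℂ}
    (hE : ∀ k, Measurable (E k)) (hEr : ∀ k θ w, E k (rotate θ w) =
      (∏ j, (AddCircle.toCircle (θ j) : ℂ) ^ α k j) * E k w) {d : Fin n → ℂ}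
    (hd : ∀ k, ∀ w ∈ polyhedron α, ‖d k‖ * ‖E k w‖ < 1) :
    ∫⁻ w in polyhedron α, φ w * ENNReal.ofReal (∏ k, (‖1 - d k * conj (E k w)‖ ^ 2)⁻¹) =
      ∫⁻ w in polyhedron α, φ w * ENNReal.ofReal (∏ k, (1 - (‖d k‖ * ‖E k w‖) ^ 2)⁻¹) := by
  have hU := hα.isOpen.measurableSet
  have hc : Measurable (conj : ℂ → ℂ) := Complex.continuous_conj.measurable
  have hm : Measurable fun w => φ w * ENNReal.ofReal (∏ k, (‖1 - d k * conj (E k w)‖ ^ 2)⁻¹) := by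
    refine hφ.mul (Measurable.ennreal_ofReal (Finset.measurable_prod _ fun k _ => ?_))
    exact ((measurable_const.sub (measurable_const.mul (hc.comp (hE k)))).norm.pow_const 2).inv
  rw [← lintegral_indicator hU, lintegral_eq_lintegral_rotate (hm.indicator hU),
    ← lintegral_indicator hU]
  refine lintegral_congr fun w => ?_
  by_cases hw : w ∈ polyhedron α
  · rw [Set.indicator_of_mem hw]
    have hlt : ∀ k, ‖d k * conj (E k w)‖ < 1 := fun k => by
      rw [norm_mul, RCLike.norm_conj]; exact hd k w hw
    have key := lintegral_torus_prod_inv_sq (det_of_exponents_ne_zero hα.det_ne_zero) hlt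
    simp only [norm_mul, RCLike.norm_conj] at key
    rw [← key, ← lintegral_const_mul]
    · refine lintegral_congr fun θ => ?_
      rw [Set.indicator_of_mem ((rotate_mem_polyhedron_iff θ w).2 hw), hφr]
      congr 2
      refine Finset.prod_congr rfl fun k _ => ?_
      rw [hEr, map_mul, mul_assoc, mul_comm (conj (E k w))]
      rfl
    · have := AddCircle.continuous_toCircle (T := 1)
      refine Measurable.ennreal_ofReal (Finset.measurable_prod _ fun k _ => ?_)
      have hχ : Measurable fun θ : UnitAddTorus (Fin n) =>
          ∏ j, (AddCircle.toCircle (θ j) : ℂ) ^ (Matrix.of α) k j := by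
        refine Finset.measurable_prod _ fun j _ => Measurable.pow_const ?_ _
        exact (by fun_prop : Continuous fun θ : UnitAddTorus (Fin n) =>
          (AddCircle.toCircle (θ j) : ℂ)).measurable
      exact ((measurable_const.sub (measurable_const.mul (hc.comp hχ))).norm.pow_const 2).inv
  · rw [Set.indicator_of_notMem hw]
    refine (lintegral_congr fun θ => ?_).trans lintegral_zero
    exact Set.indicator_of_notMem (fun h => hw ((rotate_mem_polyhedron_iff θ w).1 h)) _

/-- The one-variable Schur estimates, multiplied together over the coordinates `|e_{α k}|`. -/
theorem exists_setLIntegral_weight_le (hα : IsAdmissible α) {p s : ℝ} (hs : 0 < s) (hs1 : s < 1)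
    {β : Fin n → ℤ} (hβ : ∀ k, 0 < normWeight p α β k) :
    ∃ C : ℝ≥0, ∀ u : Fin n → ℝ, (∀ k, 0 ≤ u k) → (∀ k, u k < 1) →
      ∫⁻ w in polyhedron α, ENNReal.ofReal (‖laurentMonomial β w‖ ^ p *
        ∏ k, ((1 - ‖laurentMonomial (α k) w‖) ^ (-s) *
          (1 - u k * ‖laurentMonomial (α k) w‖)⁻¹)) ≤
        C * ENNReal.ofReal (∏ k, (1 - u k) ^ (-s)) := by
  choose C hC using fun k => exists_lintegral_exp_le (hβ k) hs hs1
  refine ⟨Real.toNNReal (volumeConst α) * ∏ k, C k, fun u hu0 hu1 => ?_⟩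
  have hU := hα.isOpen.measurableSet
  set h : Fin n → ℝ → ℝ≥0∞ := fun k y => ENNReal.ofReal (Real.exp (-(p * weight α β k * y)) *
    ((1 - Real.exp (-y)) ^ (-s) * (1 - u k * Real.exp (-y))⁻¹)) with hh
  have e1 : ∫⁻ w in polyhedron α, ENNReal.ofReal (‖laurentMonomial β w‖ ^ p *
        ∏ k, ((1 - ‖laurentMonomial (α k) w‖) ^ (-s) *
          (1 - u k * ‖laurentMonomial (α k) w‖)⁻¹)) =
      ∫⁻ w in polyhedron α, ∏ k, h k (level α w k) := by
    refine lintegral_congr_ae ?_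
    filter_upwards [ae_restrict_of_ae ae_forall_ne_zero, ae_restrict_of_ae ae_mem_polyhedron_iff,
      ae_restrict_mem hU] with w hw0 hiff hw
    have hy := hiff.1 hw
    have hE : ∀ k, Real.exp (-level α w k) < 1 := fun k =>
      Real.exp_lt_one_iff.2 (by linarith [hy k])
    simp only [hh]
    rw [← ENNReal.ofReal_prod_of_nonneg, norm_laurentMonomial_eq_prod hα.det_ne_zero β hw0,
      ← Real.finsetProd_rpow _ _ fun k _ => (Real.exp_pos _).le, ← Finset.prod_mul_distrib]
    · congr 1
      refine Finset.prod_congr rfl fun k _ => ?_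
      rw [norm_laurentMonomial_eq_exp_level hw0, ← Real.exp_mul]
      congr 2
      ring
    · intro k _
      have h1 : 0 ≤ 1 - Real.exp (-level α w k) := by linarith [hE k]
      have h2 : 0 ≤ 1 - u k * Real.exp (-level α w k) := by
        nlinarith [hE k, hu0 k, hu1 k, Real.exp_pos (-level α w k)]
      positivity
  rw [e1, setLIntegral_prod_level hα.det_ne_zero hU fun k => by fun_prop]
  have e2 : ∀ k, ∫⁻ y in Set.Ioi 0, h k y * ENNReal.ofReal (Real.exp (-(volumeWeight α k * y))) ≤
      C k * ENNReal.ofReal ((1 - u k) ^ (-s)) := fun k => by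
    refine le_of_eq_of_le (lintegral_congr fun y => ?_) (hC k (u k) (hu0 k) (hu1 k))
    have hexp : Real.exp (-(normWeight p α β k * y)) =
        Real.exp (-(volumeWeight α k * y)) * Real.exp (-(p * weight α β k * y)) := by
      rw [← Real.exp_add, normWeight]
      congr 1
      ring
    rw [mul_comm, ← ENNReal.ofReal_mul (Real.exp_pos _).le, hexp]
    congr 1
    ring
  calc _ ≤ ENNReal.ofReal (volumeConst α) * ∏ k, (C k * ENNReal.ofReal ((1 - u k) ^ (-s))) := by
        gcongr with k _
        exact e2 k
    _ = _ := by
        rw [Finset.prod_mul_distrib, ENNReal.ofReal_prod_of_nonneg fun k _ =>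
          Real.rpow_nonneg (by linarith [hu1 k]) _]
        push_cast
        rw [mul_assoc]
        rfl

theorem inv_one_sub_sq_le {r u v : ℝ} (hr : 0 < r) (hu0 : 0 ≤ u) (hu1 : u < 1) (hv0 : 0 ≤ v)
    (hv1 : v < 1) : (1 - (u * v ^ r) ^ 2)⁻¹ ≤ (min 1 r)⁻¹ * (1 - u * v)⁻¹ := by
  have hm : 0 < min 1 r := lt_min one_pos hr
  have h1 : min 1 r * (1 - v) ≤ 1 - v ^ r := by
    rcases le_total 1 r with h | h
    · rw [min_eq_left h]
      have : v ^ r ≤ v ^ (1 : ℝ) := Real.rpow_le_rpow_of_exponent_ge' hv0 hv1.le zero_le_one h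
      rw [Real.rpow_one] at this
      linarith
    · rw [min_eq_right h]
      have := rpow_one_add_le_one_add_mul_self (s := v - 1) (by linarith) hr.le h
      rw [add_sub_cancel] at this
      linarith
  have hvr0 : 0 ≤ v ^ r := Real.rpow_nonneg hv0 r
  have hvr1 : v ^ r ≤ 1 := Real.rpow_le_one hv0 hv1.le hr.le
  have huv : u * v < 1 := by nlinarith
  have ht0 : 0 ≤ u * v ^ r := by positivity
  have ht1 : u * v ^ r < 1 := by nlinarith
  -- `1 - u * v ^ r = (1 - u) + u * (1 - v ^ r)` dominates the same expression with `r = 1`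
  have h2 : min 1 r * (1 - u * v) ≤ 1 - (u * v ^ r) ^ 2 := by
    have hm1 : min 1 r ≤ 1 := min_le_left _ _
    calc min 1 r * (1 - u * v) = min 1 r * (1 - u) + u * (min 1 r * (1 - v)) := by ring
      _ ≤ 1 * (1 - u) + u * (1 - v ^ r) := by
          gcongr
      _ = 1 - u * v ^ r := by ring
      _ ≤ 1 - (u * v ^ r) ^ 2 := by nlinarith
  rw [← mul_inv]
  exact inv_anti₀ (mul_pos hm (by linarith)) h2

/-- The test function for Schur's test of the kernel `majorant p α β`. The factor `|e_β|` makes the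
integrand in both Schur estimates carry the weight `|e_β| ^ p`, which is integrable. -/
def testFunction (p : ℝ) (α : Fin n → Fin n → ℤ) (β : Fin n → ℤ) (w : Fin n → ℂ) : ℝ≥0∞ :=
  ENNReal.ofReal (‖laurentMonomial β w‖ * ∏ k, (1 - ‖laurentMonomial (α k) w‖) ^ (-(1 / p)))

theorem measurable_testFunction (p : ℝ) (β : Fin n → ℤ) : Measurable (testFunction p α β) := by
  unfold testFunction
  fun_prop

theorem testFunction_rotate (p : ℝ) (β : Fin n → ℤ) (θ : UnitAddTorus (Fin n)) (w : Fin n → ℂ) :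
    testFunction p α β (rotate θ w) = testFunction p α β w := by
  simp only [testFunction, norm_laurentMonomial_rotate]

@[fun_prop]
theorem measurable_twistedProduct (p : ℝ) (β : Fin n → ℤ) :
    Measurable fun x : (Fin n → ℂ) × (Fin n → ℂ) => twistedProduct p β x.1 x.2 := by
  have h1 : Measurable fun w => conj (laurentMonomial β (twist p w)) :=
    Complex.continuous_conj.measurable.comp
      ((measurable_laurentMonomial β).comp (measurable_twist p))
  exact ((measurable_laurentMonomial β).comp measurable_fst).mul (h1.comp measurable_snd)

@[fun_prop]
theorem measurable_majorant (p : ℝ) (β : Fin n → ℤ) :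
    Measurable fun x : (Fin n → ℂ) × (Fin n → ℂ) => majorant p α β x.1 x.2 := by
  unfold majorant
  fun_prop

theorem rpow_testFunction {p : ℝ} (hp : 1 < p) (β : Fin n → ℤ) {w : Fin n → ℂ}
    (hw : w ∈ polyhedron α) : testFunction p α β w ^ (p - 1) =
      ENNReal.ofReal (‖laurentMonomial β w‖ ^ (p - 1) *
        ∏ k, (1 - ‖laurentMonomial (α k) w‖) ^ (-((p - 1) / p))) := by
  have hnn : ∀ k, 0 ≤ 1 - ‖laurentMonomial (α k) w‖ := fun k => by linarith [(hw k).2]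
  have hnn' : ∀ k ∈ Finset.univ, 0 ≤ (1 - ‖laurentMonomial (α k) w‖) ^ (-(1 / p)) := fun k _ =>
    Real.rpow_nonneg (hnn k) _
  rw [testFunction, ENNReal.ofReal_rpow_of_nonneg (mul_nonneg (norm_nonneg _)
    (Finset.prod_nonneg hnn')) (by linarith), Real.mul_rpow (norm_nonneg _)
    (Finset.prod_nonneg hnn'), ← Real.finsetProd_rpow _ _ hnn']
  congr 2
  refine Finset.prod_congr rfl fun k _ => ?_
  rw [← Real.rpow_mul (hnn k)]
  congr 1
  ring

/-- `testFunction` as the right-hand test function of Schur's test: after averaging over the torus,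
the integrand is `|e_β| ^ p` times a product of one-variable Hilbert-type kernels. -/
theorem exists_setLIntegral_majorant_right_le (hα : IsAdmissible α) {p : ℝ} (hp : 1 < p)
    {β : Fin n → ℤ} (hβ : ∀ k, 0 < normWeight p α β k) :
    ∃ C : ℝ≥0, ∀ z ∈ polyhedron α,
      ∫⁻ w in polyhedron α, ENNReal.ofReal (majorant p α β z w) * testFunction p α β w ≤
        C * testFunction p α β z := by
  have hp0 : 0 < p := by linarith
  obtain ⟨C, hC⟩ := exists_setLIntegral_weight_le hα (s := 1 / p) (by positivity)
    (by rw [div_lt_one hp0]; exact hp) hβ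
  have hr : 0 < p - 1 := by linarith
  have hm : 0 < min 1 (p - 1) := lt_min one_pos hr
  refine ⟨Real.toNNReal ((min 1 (p - 1))⁻¹ ^ n) * C, fun z hz => ?_⟩
  calc ∫⁻ w in polyhedron α, ENNReal.ofReal (majorant p α β z w) * testFunction p α β w
      = ∫⁻ w in polyhedron α, (ENNReal.ofReal (‖laurentMonomial β z‖ *
          ‖laurentMonomial β w‖ ^ (p - 1)) * testFunction p α β w) *
          ENNReal.ofReal (∏ k, (‖1 - laurentMonomial (α k) z *
            conj (laurentMonomial (α k) (twist p w))‖ ^ 2)⁻¹) := by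
        refine lintegral_congr fun w => ?_
        rw [majorant, ENNReal.ofReal_mul (by positivity)]
        simp only [twistedProduct]
        ring
    _ = ∫⁻ w in polyhedron α, (ENNReal.ofReal (‖laurentMonomial β z‖ *
          ‖laurentMonomial β w‖ ^ (p - 1)) * testFunction p α β w) *
          ENNReal.ofReal (∏ k, (1 - (‖laurentMonomial (α k) z‖ *
            ‖laurentMonomial (α k) (twist p w)‖) ^ 2)⁻¹) := by
        refine setLIntegral_mul_prod_inv_sq hα ?_ (fun θ w => ?_)
          (E := fun k w => laurentMonomial (α k) (twist p w)) (fun k => by fun_prop)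
          (fun k θ w => ?_) (fun k w hw => ?_)
        · have := measurable_testFunction (α := α) p β
          fun_prop
        · rw [norm_laurentMonomial_rotate, testFunction_rotate]
        · rw [twist_rotate, laurentMonomial_rotate]
        · rw [norm_laurentMonomial_twist hp, ← norm_twistedProduct hp]
          exact norm_twistedProduct_lt_one hp hz hw k
    _ ≤ ∫⁻ w in polyhedron α, ENNReal.ofReal ((min 1 (p - 1))⁻¹ ^ n * ‖laurentMonomial β z‖) *
          ENNReal.ofReal (‖laurentMonomial β w‖ ^ p *
            ∏ k, ((1 - ‖laurentMonomial (α k) w‖) ^ (-(1 / p)) *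
              (1 - ‖laurentMonomial (α k) z‖ * ‖laurentMonomial (α k) w‖)⁻¹)) := by
        refine setLIntegral_mono' hα.isOpen.measurableSet fun w hw => ?_
        have hnn : ∀ k, 0 ≤ (1 - ‖laurentMonomial (α k) w‖) ^ (-(1 / p)) := fun k =>
          Real.rpow_nonneg (by linarith [(hw k).2]) _
        have hprod := Finset.prod_nonneg fun k (_ : k ∈ Finset.univ) => hnn k
        rw [testFunction, ← ENNReal.ofReal_mul (by positivity), ← ENNReal.ofReal_mul
          (by positivity), ← ENNReal.ofReal_mul (by positivity)]
        refine ENNReal.ofReal_le_ofReal ?_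
        have hb : ∏ k, (1 - (‖laurentMonomial (α k) z‖ *
            ‖laurentMonomial (α k) (twist p w)‖) ^ 2)⁻¹ ≤ (min 1 (p - 1))⁻¹ ^ n *
              ∏ k, (1 - ‖laurentMonomial (α k) z‖ * ‖laurentMonomial (α k) w‖)⁻¹ := by
          have : (min 1 (p - 1))⁻¹ ^ n = ∏ _k : Fin n, (min 1 (p - 1))⁻¹ := by simp
          rw [this, ← Finset.prod_mul_distrib]
          refine Finset.prod_le_prod (fun k _ => ?_) fun k _ => ?_
          · have h1 := norm_twistedProduct_lt_one hp hz hw k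
            rw [norm_twistedProduct hp, ← norm_laurentMonomial_twist hp] at h1
            refine inv_nonneg.2 (sub_nonneg.2 (pow_le_one₀ (by positivity) h1.le))
          · rw [norm_laurentMonomial_twist hp]
            exact inv_one_sub_sq_le hr (norm_nonneg _) (hz k).2 (norm_nonneg _) (hw k).2
        have hpow : ‖laurentMonomial β w‖ ^ (p - 1) * ‖laurentMonomial β w‖ =
            ‖laurentMonomial β w‖ ^ p := by
          rw [← Real.rpow_add_one' (norm_nonneg _) (by linarith), sub_add_cancel]
        calc _ ≤ (‖laurentMonomial β z‖ * ‖laurentMonomial β w‖ ^ (p - 1) *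
              (‖laurentMonomial β w‖ * ∏ k, (1 - ‖laurentMonomial (α k) w‖) ^ (-(1 / p)))) *
              ((min 1 (p - 1))⁻¹ ^ n *
                ∏ k, (1 - ‖laurentMonomial (α k) z‖ * ‖laurentMonomial (α k) w‖)⁻¹) := by gcongr
          _ = _ := by
              rw [Finset.prod_mul_distrib, ← hpow]
              ring
    _ ≤ ENNReal.ofReal ((min 1 (p - 1))⁻¹ ^ n * ‖laurentMonomial β z‖) *
          (C * ENNReal.ofReal (∏ k, (1 - ‖laurentMonomial (α k) z‖) ^ (-(1 / p)))) := by
        rw [lintegral_const_mul' _ _ ENNReal.ofReal_ne_top]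
        gcongr
        exact hC _ (fun k => norm_nonneg _) fun k => (hz k).2
    _ = _ := by
        rw [testFunction, ENNReal.ofReal_mul (by positivity), ENNReal.ofReal_mul (by positivity),
          ENNReal.coe_mul]
        change _ = ENNReal.ofReal _ * _ * _
        ring

/-- `testFunction` as the left-hand test function of Schur's test. As `majorant` is not symmetric,
the exponents differ from those of `exists_setLIntegral_majorant_right_le`. -/
theorem exists_setLIntegral_majorant_left_le (hα : IsAdmissible α) {p : ℝ} (hp : 1 < p)
    {β : Fin n → ℤ} (hβ : ∀ k, 0 < normWeight p α β k) :
    ∃ C : ℝ≥0, ∀ w ∈ polyhedron α,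
      ∫⁻ z in polyhedron α, ENNReal.ofReal (majorant p α β z w) *
        testFunction p α β z ^ (p - 1) ≤ C * testFunction p α β w ^ (p - 1) := by
  have hp0 : 0 < p := by linarith
  have hr : 0 < p - 1 := by linarith
  obtain ⟨C, hC⟩ := exists_setLIntegral_weight_le hα (s := (p - 1) / p) (by positivity)
    (by rw [div_lt_one hp0]; linarith) hβ
  have hm : 0 < min 1 (p - 1) := lt_min one_pos hr
  refine ⟨Real.toNNReal ((min 1 (p - 1))⁻¹ ^ n) * C, fun w hw => ?_⟩
  calc ∫⁻ z in polyhedron α, ENNReal.ofReal (majorant p α β z w) * testFunction p α β z ^ (p - 1)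
      = ∫⁻ z in polyhedron α, (ENNReal.ofReal (‖laurentMonomial β z‖ *
          ‖laurentMonomial β w‖ ^ (p - 1)) * testFunction p α β z ^ (p - 1)) *
          ENNReal.ofReal (∏ k, (‖1 - laurentMonomial (α k) (twist p w) *
            conj (laurentMonomial (α k) z)‖ ^ 2)⁻¹) := by
        refine lintegral_congr fun z => ?_
        have hconj : ∀ k, ‖1 - laurentMonomial (α k) (twist p w) *
            conj (laurentMonomial (α k) z)‖ = ‖1 - twistedProduct p (α k) z w‖ := fun k => by
          rw [← RCLike.norm_conj, twistedProduct]
          simp [mul_comm]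
        simp_rw [hconj]
        rw [majorant, ENNReal.ofReal_mul (by positivity)]
        ring
    _ = ∫⁻ z in polyhedron α, (ENNReal.ofReal (‖laurentMonomial β z‖ *
          ‖laurentMonomial β w‖ ^ (p - 1)) * testFunction p α β z ^ (p - 1)) *
          ENNReal.ofReal (∏ k, (1 - (‖laurentMonomial (α k) (twist p w)‖ *
            ‖laurentMonomial (α k) z‖) ^ 2)⁻¹) := by
        refine setLIntegral_mul_prod_inv_sq hα ?_ (fun θ z => ?_)
          (E := fun k z => laurentMonomial (α k) z) (fun k => by fun_prop)
          (fun k θ z => ?_) (fun k z hz => ?_)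
        · have := measurable_testFunction (α := α) p β
          fun_prop
        · rw [norm_laurentMonomial_rotate, testFunction_rotate]
        · rw [laurentMonomial_rotate]
        · rw [norm_laurentMonomial_twist hp, mul_comm, ← norm_twistedProduct hp]
          exact norm_twistedProduct_lt_one hp hz hw k
    _ ≤ ∫⁻ z in polyhedron α,
          ENNReal.ofReal ((min 1 (p - 1))⁻¹ ^ n * ‖laurentMonomial β w‖ ^ (p - 1)) *
          ENNReal.ofReal (‖laurentMonomial β z‖ ^ p *
            ∏ k, ((1 - ‖laurentMonomial (α k) z‖) ^ (-((p - 1) / p)) *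
              (1 - ‖laurentMonomial (α k) w‖ * ‖laurentMonomial (α k) z‖)⁻¹)) := by
        refine setLIntegral_mono' hα.isOpen.measurableSet fun z hz => ?_
        have hnn : ∀ k, 0 ≤ (1 - ‖laurentMonomial (α k) z‖) ^ (-((p - 1) / p)) := fun k =>
          Real.rpow_nonneg (by linarith [(hz k).2]) _
        have hprod := Finset.prod_nonneg fun k (_ : k ∈ Finset.univ) => hnn k
        rw [rpow_testFunction hp β hz, ← ENNReal.ofReal_mul (by positivity), ← ENNReal.ofReal_mul
          (by positivity), ← ENNReal.ofReal_mul (by positivity)]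
        refine ENNReal.ofReal_le_ofReal ?_
        have hb : ∏ k, (1 - (‖laurentMonomial (α k) (twist p w)‖ *
            ‖laurentMonomial (α k) z‖) ^ 2)⁻¹ ≤ (min 1 (p - 1))⁻¹ ^ n *
              ∏ k, (1 - ‖laurentMonomial (α k) w‖ * ‖laurentMonomial (α k) z‖)⁻¹ := by
          have : (min 1 (p - 1))⁻¹ ^ n = ∏ _k : Fin n, (min 1 (p - 1))⁻¹ := by simp
          rw [this, ← Finset.prod_mul_distrib]
          refine Finset.prod_le_prod (fun k _ => ?_) fun k _ => ?_
          · have h1 := norm_twistedProduct_lt_one hp hz hw k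
            rw [norm_twistedProduct hp, ← norm_laurentMonomial_twist hp, mul_comm] at h1
            refine inv_nonneg.2 (sub_nonneg.2 (pow_le_one₀ (by positivity) h1.le))
          · rw [norm_laurentMonomial_twist hp, mul_comm, mul_comm ‖laurentMonomial (α k) w‖]
            exact inv_one_sub_sq_le hr (norm_nonneg _) (hz k).2 (norm_nonneg _) (hw k).2
        have hpow : ‖laurentMonomial β z‖ ^ (p - 1) * ‖laurentMonomial β z‖ =
            ‖laurentMonomial β z‖ ^ p := by
          rw [← Real.rpow_add_one' (norm_nonneg _) (by linarith), sub_add_cancel]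
        calc _ ≤ (‖laurentMonomial β z‖ * ‖laurentMonomial β w‖ ^ (p - 1) *
              (‖laurentMonomial β z‖ ^ (p - 1) *
                ∏ k, (1 - ‖laurentMonomial (α k) z‖) ^ (-((p - 1) / p)))) *
              ((min 1 (p - 1))⁻¹ ^ n *
                ∏ k, (1 - ‖laurentMonomial (α k) w‖ * ‖laurentMonomial (α k) z‖)⁻¹) := by gcongr
          _ = _ := by
              rw [Finset.prod_mul_distrib, ← hpow]
              ring
    _ ≤ ENNReal.ofReal ((min 1 (p - 1))⁻¹ ^ n * ‖laurentMonomial β w‖ ^ (p - 1)) *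
          (C * ENNReal.ofReal (∏ k, (1 - ‖laurentMonomial (α k) w‖) ^ (-((p - 1) / p)))) := by
        rw [lintegral_const_mul' _ _ ENNReal.ofReal_ne_top]
        gcongr
        exact hC _ (fun k => norm_nonneg _) fun k => (hw k).2
    _ = _ := by
        rw [rpow_testFunction hp β hw, ENNReal.ofReal_mul (by positivity),
          ENNReal.ofReal_mul (by positivity), ENNReal.coe_mul]
        change _ = ENNReal.ofReal _ * _ * _
        ring

theorem exists_lintegral_majorant_rpow_le (hα : IsAdmissible α) {p : ℝ} (hp : 1 < p)
    {β : Fin n → ℤ} (hβ : ∀ k, 0 < normWeight p α β k) :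
    ∃ C : ℝ≥0, ∀ g : (Fin n → ℂ) → ℝ≥0∞, AEMeasurable g (volume.restrict (polyhedron α)) →
      ∫⁻ z in polyhedron α, (∫⁻ w in polyhedron α,
        ENNReal.ofReal (majorant p α β z w) * g w) ^ p ≤
          C * ∫⁻ w in polyhedron α, g w ^ p := by
  obtain ⟨C₁, h₁⟩ := exists_setLIntegral_majorant_right_le hα hp hβ
  obtain ⟨C₂, h₂⟩ := exists_setLIntegral_majorant_left_le hα hp hβ
  have hU := hα.isOpen.measurableSet
  refine ⟨C₁ ^ (p - 1) * C₂, fun g hg => ?_⟩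
  have hK : Measurable (Function.uncurry fun z w => ENNReal.ofReal (majorant p α β z w)) :=
    (measurable_majorant p β).ennreal_ofReal
  have ha := measurable_testFunction (α := α) p β
  rw [ENNReal.coe_mul, ENNReal.coe_rpow_of_nonneg _ (by linarith : (0 : ℝ) ≤ p - 1)]
  refine schur_test hp hK ha ha ?_ (ae_of_all _ fun w => ENNReal.ofReal_ne_top)
    ((ae_restrict_iff' hU).2 (ae_of_all _ h₁)) ((ae_restrict_iff' hU).2 (ae_of_all _ h₂)) hg
  filter_upwards [ae_restrict_of_ae ae_forall_ne_zero, ae_restrict_mem hU] with w hw0 hw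
  rw [testFunction, Ne, ENNReal.ofReal_eq_zero, not_le, norm_laurentMonomial_eq_exp β hw0]
  exact mul_pos (Real.exp_pos _) (Finset.prod_pos fun k _ =>
    Real.rpow_pos_of_pos (by linarith [(hw k).2]) _)

/-! ### Boundedness of the absolute operator -/

theorem normWeight_pos_of_mem {p : ℝ} {β : Fin n → ℤ} (hβ : β ∈ fundamentalIndices p α)
    (k : Fin n) : 0 < normWeight p α β k :=
  (hβ k).1.1

theorem measurable_tsum_closedKernel (hα : IsAdmissible α) {p : ℝ} (hp : 0 < p) :
    Measurable fun x : (Fin n → ℂ) × (Fin n → ℂ) =>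
      ∑' β : fundamentalIndices p α, closedKernel p α β x.1 x.2 := by
  have := (finite_fundamentalIndices hα hp).fintype
  simp_rw [tsum_fintype]
  refine Finset.measurable_sum _ fun β _ => ?_
  unfold closedKernel
  fun_prop

theorem exists_lintegral_enorm_kernel_le (hα : IsAdmissible α) {p : ℝ} (hp : 1 < p) :
    ∃ C : ℝ≥0, ∀ g : (Fin n → ℂ) → ℝ≥0∞, AEMeasurable g (volume.restrict (polyhedron α)) →
      ∫⁻ z in polyhedron α, (∫⁻ w in polyhedron α,
        ‖monomialBasisKernel p (polyhedron α) z w‖ₑ * g w) ^ p ≤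
          C * ∫⁻ w in polyhedron α, g w ^ p := by
  have hp0 : 0 < p := by linarith
  have hU := hα.isOpen.measurableSet
  have := (finite_fundamentalIndices hα hp0).fintype
  choose C hC using fun β : fundamentalIndices p α =>
    exists_lintegral_majorant_rpow_le hα hp (normWeight_pos_of_mem β.2)
  set D : fundamentalIndices p α → ℝ := fun β => (volumeConst α)⁻¹ *
    (∏ k, (|normWeight p α β k| + |p - normWeight p α β k|)) with hD
  have hD0 : ∀ β, 0 ≤ D β := fun β => by
    have := volumeConst_pos hα.det_ne_zero
    positivity
  refine ⟨(Fintype.card (fundamentalIndices p α) : ℝ≥0) ^ (p - 1) *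
    ∑ β, (D β).toNNReal ^ p * C β, fun g hg => ?_⟩
  have hm : ∀ β : fundamentalIndices p α, AEMeasurable (fun x : (Fin n → ℂ) × (Fin n → ℂ) =>
      ENNReal.ofReal (majorant p α β x.1 x.2) * g x.2)
        ((volume.restrict (polyhedron α)).prod (volume.restrict (polyhedron α))) := fun β =>
    (measurable_majorant p (β : Fin n → ℤ)).ennreal_ofReal.aemeasurable.mul hg.comp_snd
  have hm1 : ∀ (β : fundamentalIndices p α) (z : Fin n → ℂ), AEMeasurable (fun w =>
      ENNReal.ofReal (majorant p α β z w) * g w) (volume.restrict (polyhedron α)) := fun β z =>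
    ((measurable_majorant p (β : Fin n → ℤ)).comp
      measurable_prodMk_left).ennreal_ofReal.aemeasurable.mul hg
  have hpt : ∀ z ∈ polyhedron α, ∫⁻ w in polyhedron α,
      ‖monomialBasisKernel p (polyhedron α) z w‖ₑ * g w ≤
      ∑ β : fundamentalIndices p α, ENNReal.ofReal (D β) *
        ∫⁻ w in polyhedron α, ENNReal.ofReal (majorant p α β z w) * g w := by
    intro z hz
    simp_rw [← lintegral_const_mul' _ _ ENNReal.ofReal_ne_top]
    rw [← lintegral_finsetSum' _ fun β _ => (hm1 β z).const_mul _]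
    refine setLIntegral_mono' hU fun w hw => ?_
    simp_rw [← mul_assoc]
    rw [← Finset.sum_mul]
    gcongr
    rw [monomialBasisKernel_eq_tsum hα hp hz hw, tsum_fintype]
    refine (enorm_sum_le _ _).trans (Finset.sum_le_sum fun β _ => ?_)
    rw [← ofReal_norm, ← ENNReal.ofReal_mul (hD0 β)]
    exact ENNReal.ofReal_le_ofReal (norm_closedKernel_le hα hp _ hz hw)
  calc _ ≤ ∫⁻ z in polyhedron α, (Fintype.card (fundamentalIndices p α) : ℝ≥0∞) ^ (p - 1) *
          ∑ β : fundamentalIndices p α, (ENNReal.ofReal (D β) *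
            ∫⁻ w in polyhedron α, ENNReal.ofReal (majorant p α β z w) * g w) ^ p := by
        refine setLIntegral_mono' hU fun z hz => ?_
        exact (ENNReal.rpow_le_rpow (hpt z hz) hp0.le).trans
          (ENNReal.rpow_sum_le_const_mul_sum_rpow _ _ hp.le)
    _ = (Fintype.card (fundamentalIndices p α) : ℝ≥0∞) ^ (p - 1) *
          ∑ β : fundamentalIndices p α, ENNReal.ofReal (D β) ^ p * ∫⁻ z in polyhedron α,
            (∫⁻ w in polyhedron α, ENNReal.ofReal (majorant p α β z w) * g w) ^ p := by
        rw [lintegral_const_mul' _ _ (ENNReal.rpow_ne_top_of_nonneg (by linarith)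
          (ENNReal.natCast_ne_top _)), lintegral_finsetSum' _ fun β _ =>
            ((hm β).lintegral_prod_right'.const_mul _).pow_const _]
        simp_rw [ENNReal.mul_rpow_of_nonneg _ _ hp0.le]
        congr 1
        refine Finset.sum_congr rfl fun β _ => ?_
        rw [lintegral_const_mul' _ _ (ENNReal.rpow_ne_top_of_nonneg hp0.le ENNReal.ofReal_ne_top)]
    _ ≤ (Fintype.card (fundamentalIndices p α) : ℝ≥0∞) ^ (p - 1) *
          ∑ β : fundamentalIndices p α, ENNReal.ofReal (D β) ^ p *
            (C β * ∫⁻ w in polyhedron α, g w ^ p) := by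
        gcongr with β _
        exact hC β g hg
    _ = _ := by
        simp_rw [← mul_assoc]
        rw [← Finset.sum_mul, ← mul_assoc]
        congr 1
        push_cast
        rw [ENNReal.coe_rpow_of_nonneg _ (by linarith : (0 : ℝ) ≤ p - 1)]
        simp_rw [ENNReal.coe_rpow_of_nonneg _ hp0.le]
        simp [ENNReal.ofReal]

theorem exists_eLpNorm_absoluteOperator_le (hα : IsAdmissible α) {p : ℝ} (hp : 1 < p) :
    ∃ C : ℝ≥0, ∀ f : (Fin n → ℂ) → ℂ,
      MemLp f (ENNReal.ofReal p) (volume.restrict (polyhedron α)) →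
      (∀ᵐ z ∂(volume.restrict (polyhedron α)), IntegrableOn
        (fun w => ‖monomialBasisKernel p (polyhedron α) z w‖ • f w) (polyhedron α)) ∧
      MemLp (absoluteOperator p (polyhedron α) f) (ENNReal.ofReal p)
        (volume.restrict (polyhedron α)) ∧
      eLpNorm (absoluteOperator p (polyhedron α) f) (ENNReal.ofReal p)
        (volume.restrict (polyhedron α)) ≤
          C * eLpNorm f (ENNReal.ofReal p) (volume.restrict (polyhedron α)) := by
  have hp0 : 0 < p := by linarith
  have hU := hα.isOpen.measurableSet
  obtain ⟨C, hC⟩ := exists_lintegral_enorm_kernel_le hα hp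
  refine ⟨C ^ (1 / p), fun f hf => ?_⟩
  have hpe : ENNReal.ofReal p ≠ 0 := by simpa using hp0
  have hnorm : ∀ F : (Fin n → ℂ) → ℂ,
      eLpNorm F (ENNReal.ofReal p) (volume.restrict (polyhedron α)) =
        (∫⁻ z in polyhedron α, ‖F z‖ₑ ^ p) ^ (1 / p) := fun F => by
    rw [eLpNorm_eq_lintegral_rpow_enorm_toReal hpe ENNReal.ofReal_ne_top,
      ENNReal.toReal_ofReal hp0.le]
  have hfL : ∫⁻ w in polyhedron α, ‖f w‖ₑ ^ p < ∞ := by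
    have := (eLpNorm_lt_top_iff_lintegral_rpow_enorm_lt_top hpe ENNReal.ofReal_ne_top).1 hf.2
    rwa [ENNReal.toReal_ofReal hp0.le] at this
  have hbound := hC (fun w => ‖f w‖ₑ) hf.1.enorm
  set L : (Fin n → ℂ) → (Fin n → ℂ) → ℂ := fun z w =>
    ∑' β : fundamentalIndices p α, closedKernel p α β z w with hL
  have hLm := measurable_tsum_closedKernel hα hp0
  have hKL : ∀ z ∈ polyhedron α, ∀ w ∈ polyhedron α,
      monomialBasisKernel p (polyhedron α) z w = L z w := fun z hz w hw =>
    monomialBasisKernel_eq_tsum hα hp hz hw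
  have hprod : AEStronglyMeasurable (fun x : (Fin n → ℂ) × (Fin n → ℂ) => ‖L x.1 x.2‖ • f x.2)
      ((volume.restrict (polyhedron α)).prod (volume.restrict (polyhedron α))) :=
    hLm.norm.aestronglyMeasurable.smul hf.1.comp_snd
  have hmeas : AEStronglyMeasurable (absoluteOperator p (polyhedron α) f)
      (volume.restrict (polyhedron α)) := by
    refine hprod.integral_prod_right'.congr ?_
    filter_upwards [ae_restrict_mem hU] with z hz
    exact setIntegral_congr_fun hU fun w hw => by simp only [hKL z hz w hw]
  have hG : AEMeasurable (fun z => ∫⁻ w in polyhedron α,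
      ‖monomialBasisKernel p (polyhedron α) z w‖ₑ * ‖f w‖ₑ) (volume.restrict (polyhedron α)) := by
    have hm : AEMeasurable (fun x : (Fin n → ℂ) × (Fin n → ℂ) => ‖L x.1 x.2‖ₑ * ‖f x.2‖ₑ)
        ((volume.restrict (polyhedron α)).prod (volume.restrict (polyhedron α))) :=
      hLm.enorm.aemeasurable.mul hf.1.enorm.comp_snd
    refine hm.lintegral_prod_right'.congr ?_
    filter_upwards [ae_restrict_mem hU] with z hz
    exact setLIntegral_congr_fun hU fun w hw => by simp only [hKL z hz w hw]
  have hle : ∀ z, ‖absoluteOperator p (polyhedron α) f z‖ₑ ≤ ∫⁻ w in polyhedron α,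
      ‖monomialBasisKernel p (polyhedron α) z w‖ₑ * ‖f w‖ₑ := fun z => by
    refine (enorm_integral_le_lintegral_enorm _).trans_eq (lintegral_congr fun w => ?_)
    rw [enorm_smul, enorm_norm]
  have hfinal : eLpNorm (absoluteOperator p (polyhedron α) f) (ENNReal.ofReal p)
      (volume.restrict (polyhedron α)) ≤ ((C ^ (1 / p) : ℝ≥0) : ℝ≥0∞) *
        eLpNorm f (ENNReal.ofReal p) (volume.restrict (polyhedron α)) := by
    rw [hnorm, hnorm, ENNReal.coe_rpow_of_nonneg _ (by positivity),
      ← ENNReal.mul_rpow_of_nonneg _ _ (by positivity)]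
    refine ENNReal.rpow_le_rpow (le_trans ?_ hbound) (by positivity)
    exact lintegral_mono fun z => ENNReal.rpow_le_rpow (hle z) hp0.le
  refine ⟨?_, ⟨hmeas, hfinal.trans_lt (ENNReal.mul_lt_top ENNReal.coe_lt_top hf.2)⟩, hfinal⟩
  have hlt : ∀ᵐ z ∂(volume.restrict (polyhedron α)), (∫⁻ w in polyhedron α,
      ‖monomialBasisKernel p (polyhedron α) z w‖ₑ * ‖f w‖ₑ) ^ p < ∞ :=
    ae_lt_top' (hG.pow_const _) (hbound.trans_lt (ENNReal.mul_lt_top ENNReal.coe_lt_top hfL)).ne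
  filter_upwards [hlt, ae_restrict_mem hU] with z hz hzU
  refine ⟨?_, ?_⟩
  · have hLz : Measurable fun w => ‖L z w‖ := (hLm.comp measurable_prodMk_left).norm
    refine (hLz.aestronglyMeasurable.smul hf.1).congr ?_
    filter_upwards [ae_restrict_mem hU] with w hw
    simp only [hKL z hzU w hw, Pi.smul_apply']
  · rw [HasFiniteIntegral]
    simp_rw [enorm_smul, enorm_norm]
    exact (ENNReal.rpow_lt_top_iff_of_pos hp0).1 hz

end MonomialBasis

end

theorem theorem1p2 (n : ℕ) (U : Set (Fin n → ℂ)) (hU : MonomialBasis.IsMonomialPolyhedron U)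
    (p : ℝ) (hp : 1 < p) :
    (∀ z ∈ U, ∀ w ∈ U,
      Summable fun α : MonomialBasis.allowableIndices p U =>
        MonomialBasis.kernelTerm p U z w (α : Fin n → ℤ)) ∧
    ∃ C : ℝ≥0, ∀ f : (Fin n → ℂ) → ℂ, MemLp f (ENNReal.ofReal p) (volume.restrict U) →
      (∀ᵐ z ∂(volume.restrict U),
        IntegrableOn (fun w => ‖MonomialBasis.monomialBasisKernel p U z w‖ • f w) U) ∧
      MemLp (MonomialBasis.absoluteOperator p U f) (ENNReal.ofReal p) (volume.restrict U) ∧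
      eLpNorm (MonomialBasis.absoluteOperator p U f) (ENNReal.ofReal p) (volume.restrict U) ≤
        C * eLpNorm f (ENNReal.ofReal p) (volume.restrict U) := by
  obtain ⟨α, rfl⟩ := hU.exists_monomials
  have hα : MonomialBasis.IsAdmissible α :=
    MonomialBasis.isAdmissible_of_isBounded hU.isOpen hU.isConnected.nonempty hU.isBounded
  exact ⟨fun z hz w hw => MonomialBasis.summable_kernelTerm hα hp hz hw,
    MonomialBasis.exists_eLpNorm_absoluteOperator_le hα hp⟩
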